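/- Let $0<q<1$. For $c\in\mathbb{C}$ put $(c;q)_n=\prod_{k=0}^{n-1}(1-cq^k)$, $(c;q)_\infty=\prod_{k=0}^{\infty}(1-cq^k)$ and $(c_1,\dots,c_k;q)_\infty=(c_1;q)_\infty\cdots(c_k;q)_\infty$; for $\tau\neq0$ put $\theta_q(\tau)=(q,-\tau,-q/\tau;q)_\infty$. Let $${}_1\phi_1\!\left({c\atop d};q,x\right)=\sum_{n=0}^\infty\frac{(c;q)_n}{(d;q)_n(q;q)_n}(-1)^nq^{\binom n2}x^n\qquad(d\notin\{q^{-m}:m=0,1,2,\dots\}),$$ and let ${}_2\phi_1\!\left({a,b\atop 0};q,x\right)$ denote the analytic continuation to $\mathbb{C}\setminus\{q^{-m}:m=0,1,2,\dots\}$ of $\sum_{n=0}^\infty\frac{(a;q)_n(b;q)_n}{(q;q)_n}x^n$, $|x|<1$. Let $a,b\in\mathbb{C}$, let $\lambda\in\mathbb{C}\setminus\{0\}$ with $\lambda\notin\{-q^n:n\in\mathbb{Z}\}$, and let $z\in\mathbb{C}\setminus\{0\}$ with $z\notin\{-q^n\lambda:n\in\mathbb{Z}\}$. Define the discrete resummation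 $$U_{q,\lambda}(a,b;z)=\sum_{n=-\infty}^\infty\frac{{}_2\phi_1\!\left({a,b\atop 0};q,-q^n\lambda\right)}{\theta_q(q^n\lambda/z)}.$$ **Theorem 5.2.** The analytic continuation ${}_2\phi_1$ above exists, the series defining $U_{q,\lambda}(a,b;z)$ converges absolutely, and the following representations hold, each with an absolutely convergent series. 1. If $b\lambda\notin\{-q^n:n\in\mathbb{Z}\}$, then $$U_{q,\lambda}(a,b;z)=\sum_{n=-\infty}^\infty\frac{(-bq^n\lambda;q)_\infty\,{}_1\phi_1\!\left({b\atop -bq^n\lambda};q,-aq^n\lambda\right)}{(-q^n\lambda;q)_\infty\,\theta_q(q^n\lambda/z)}.$$ 2. If $|a|<1$, then $$U_{q,\lambda}(a,b;z)=(a;q)_\infty\sum_{n=-\infty}^\infty\frac{\left(-bq^n\lambda,-\frac{aqz}{q^n\lambda};q\right)_\infty}{(-q^n\lambda;q)_\infty\,\theta_q(q^n\lambda/z)}.$$ 3. If $|abz|<1$, then $$U_{q,\lambda}(a,b;z)=(abz;q)_\infty\sum_{n=-\infty}^\infty\frac{(-aq^n\lambda,-bq^n\lambda;q)_\infty}{(-q^n\lambda;q)_\infty\,\theta_q(q^n\lambda/z)}.$$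 4. If $0<|a|<1$, $|b|<1$ and $b\lambda\notin\{-q^n:n\in\mathbb{Z}\}$, then $$U_{q,\lambda}(a,b;z)=\frac{(a,b;q)_\infty}{(q;q)_\infty}\sum_{n=-\infty}^\infty\frac{(-bq^{n+1}\lambda;q)_\infty\,{}_1\phi_1\!\left({q/a\atop -bq^{n+1}\lambda};q,-aq^{n+1}\lambda\right)}{\theta_q(q^{n+1}\lambda)}\cdot\frac{q^n\lambda}{q^n\lambda+z}.$$ -/

import Mathlib

/-- The finite `q`-Pochhammer symbol `(a; q)_n = (1 - a)(1 - a q) ⋯ (1 - a q^(n-1))`. -/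
noncomputable def qPochFin (q : ℝ) (a : ℂ) (n : ℕ) : ℂ :=
  ∏ k ∈ Finset.range n, (1 - a * (q : ℂ) ^ k)

/-- The infinite `q`-Pochhammer symbol `(a; q)_∞ = ∏_{n ≥ 0} (1 - a q^n)`. -/
noncomputable def qPoch (q : ℝ) (a : ℂ) : ℂ :=
  ∏' n : ℕ, (1 - a * (q : ℂ) ^ n)

/-- The theta function `θ_q(τ) = (q, -τ, -q/τ; q)_∞`. -/
noncomputable def qTheta (q : ℝ) (τ : ℂ) : ℂ :=
  qPoch q (q : ℂ) * qPoch q (-τ) * qPoch q (-((q : ℂ) / τ))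

/-- The basic hypergeometric series `_rφ_s(a₁, …, a_r; b₁, …, b_s; q, x)`, where `as = [a₁, …, a_r]`
and `bs = [b₁, …, b_s]`. -/
noncomputable def qPhi (q : ℝ) (as bs : List ℂ) (x : ℂ) : ℂ :=
  ∑' n : ℕ, (as.map fun c => qPochFin q c n).prod /
      ((bs.map fun c => qPochFin q c n).prod * qPochFin q (q : ℂ) n) *
    ((-1 : ℂ) ^ n * (q : ℂ) ^ (n.choose 2)) ^ (1 + (bs.length : ℤ) - (as.length : ℤ)) * x ^ n

/-- The complex plane without the points `q^(-m)`, `m = 0, 1, 2, …`. -/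
def borelDomain (q : ℝ) : Set ℂ := {x | ∀ m : ℕ, x ≠ ((q : ℂ) ^ m)⁻¹}

/-- `F` is an analytic continuation of `x ↦ ₂φ₁(a, b; 0; q, x)` from the open unit disc, where the
series converges, to the complex plane without the points `q^(-m)`, `m = 0, 1, 2, …`. -/
def IsPhi21Continuation (q : ℝ) (a b : ℂ) (F : ℂ → ℂ) : Prop :=
  AnalyticOnNhd ℂ F (borelDomain q) ∧ ∀ x : ℂ, ‖x‖ < 1 → F x = qPhi q [a, b] [0] x

/-- There is at most one such continuation. -/
theorem IsPhi21Continuation.eqOn {q : ℝ} (hq0 : 0 < q) {a b : ℂ} {F G : ℂ → ℂ}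
    (hF : IsPhi21Continuation q a b F) (hG : IsPhi21Continuation q a b G) :
    Set.EqOn F G (borelDomain q) := by
  have hset : borelDomain q = (Set.range fun m : ℕ => ((q : ℂ) ^ m)⁻¹)ᶜ := by
    ext x
    simp [borelDomain, eq_comm]
  have hconn : IsPreconnected (borelDomain q) := by
    rw [hset]
    exact ((Set.countable_range _).isConnected_compl_of_one_lt_rank
      (by simp)).isPreconnected
  have h0 : (0 : ℂ) ∈ borelDomain q := by
    intro m h
    have hq : (q : ℂ) ≠ 0 := by exact_mod_cast hq0.ne'
    exact inv_ne_zero (pow_ne_zero m hq) h.symm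
  refine hF.1.eqOn_of_preconnected_of_eventuallyEq hG.1 hconn h0 ?_
  filter_upwards [Metric.ball_mem_nhds (0 : ℂ) one_pos] with x hx
  have hx' : ‖x‖ < 1 := by simpa using hx
  rw [hF.2 x hx', hG.2 x hx']

/-- The analytic continuation of `x ↦ ₂φ₁(a, b; 0; q, x)` to the complex plane without the points
`q^(-m)`, `m = 0, 1, 2, …`. -/
noncomputable def phi21Cont (q : ℝ) (a b : ℂ) : ℂ → ℂ :=
  Classical.epsilon (IsPhi21Continuation q a b)

/-- The `n`-th term of the discrete `q`-Borel-Laplace resummation of `₂φ₀(a, b; -; q, z)`. -/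
noncomputable def qUTerm (q : ℝ) (lam a b z : ℂ) (n : ℤ) : ℂ :=
  phi21Cont q a b (-((q : ℂ) ^ n * lam)) / qTheta q ((q : ℂ) ^ n * lam / z)

/-- The discrete resummation `U_{q,λ}(a, b; z)`, the discrete `q`-Laplace transform of
`t ↦ ₂φ₁(a, b; 0; q, -t)`. -/
noncomputable def qU (q : ℝ) (lam a b z : ℂ) : ℂ :=
  ∑' n : ℤ, qUTerm q lam a b z n

/-- The terms of the `₁φ₁` sum. -/
noncomputable def phi11Term (q : ℝ) (lam a b z : ℂ) (n : ℤ) : ℂ :=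
  qPoch q (-(b * (q : ℂ) ^ n * lam)) *
      qPhi q [b] [-(b * (q : ℂ) ^ n * lam)] (-(a * (q : ℂ) ^ n * lam)) /
    (qPoch q (-((q : ℂ) ^ n * lam)) * qTheta q ((q : ℂ) ^ n * lam / z))

/-- The terms of the `q`-Pochhammer sum. -/
noncomputable def pochTerm (q : ℝ) (lam a b z : ℂ) (n : ℤ) : ℂ :=
  qPoch q (-(b * (q : ℂ) ^ n * lam)) * qPoch q (-(a * (q : ℂ) * z / ((q : ℂ) ^ n * lam))) /
    (qPoch q (-((q : ℂ) ^ n * lam)) * qTheta q ((q : ℂ) ^ n * lam / z))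

/-- The terms of the sum that is symmetric in `a` and `b`. -/
noncomputable def symmTerm (q : ℝ) (lam a b z : ℂ) (n : ℤ) : ℂ :=
  qPoch q (-(a * (q : ℂ) ^ n * lam)) * qPoch q (-(b * (q : ℂ) ^ n * lam)) /
    (qPoch q (-((q : ℂ) ^ n * lam)) * qTheta q ((q : ℂ) ^ n * lam / z))

/-- The terms of the partial-fraction (Cauchy–Heine) sum. -/
noncomputable def cauchyHeineTerm (q : ℝ) (lam a b z : ℂ) (n : ℤ) : ℂ :=
  qPoch q (-(b * (q : ℂ) ^ (n + 1) * lam)) *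
        qPhi q [(q : ℂ) / a] [-(b * (q : ℂ) ^ (n + 1) * lam)] (-(a * (q : ℂ) ^ (n + 1) * lam)) /
      qTheta q ((q : ℂ) ^ (n + 1) * lam) *
    ((q : ℂ) ^ n * lam / ((q : ℂ) ^ n * lam + z))

/-! Write t = q^n λ, w_n = 1/θ_q(q^n λ/z) and r_n(b) = (-bt;q)_∞/(-t;q)_∞. The continuation is
explicit: the Gauss expansion of (a;q)_n and the q-binomial theorem turn ₂φ₁(a,b;0;q,x) into
1/(x;q)_∞ times an entire series (`qPhi_eq_jackson`). At x = -t that series is the ₁φ₁ form, term by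
term in n.

Two tools give the next two forms. Quasi-periodicity of theta, q^(k choose 2) t^k w_n = z^k w_{n+k}
(`weight_mul_pow`), trades a Gaussian factor for a shift of n, so that absolutely convergent double
series over (n,k) can be sheared. The iterated q-differences ∏_{i<k}(T - βq^i) have the generating
function (βx;q)_∞ Σ_j x^j T^j/(q;q)_j (`tsum_qDiff`). The terms of Jackson's series are such
differences of r in two ways. Before any shear, T is t ↦ qt and β = 1, which produces (a;q)_∞
(`expTerm_succ`, `poch_form`). After a shear, T is n ↦ n-1 and β = b, which produces (abz;q)_∞
(`outTerm_succ`, `symm_form`). In both cases a further shear leaves an Euler series in k.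

For the last form, exchange a and b in the q-Pochhammer form, and expand (-bqτ;q)_∞/θ_q(qτ), τ =
z/(q^n λ), over all its poles (`tsum_pfWeight`). A shear isolates the kernel q^n λ/(q^n λ+z). Its
coefficient is evaluated by expanding r_{n+s}(a) in partial fractions (`tsum_partialFraction`) and
using `tsum_pfWeight` a second time.

For convergence, w_n decays like q^(n(n-1)/2) in both directions, while (-bq^n λ;q)_∞ can grow at
the inverse rate as n → -∞. Where the Gaussian factors cancel, geometric rates decide. -/

open Filter Topology

namespace QBorelLaplace

variable {q : ℝ}

/-! ### Products -/

theorem qPochFin_zero (c : ℂ) : qPochFin q c 0 = 1 := by simp [qPochFin]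

theorem qPochFin_succ (c : ℂ) (n : ℕ) :
    qPochFin q c (n + 1) = qPochFin q c n * (1 - c * (q : ℂ) ^ n) := by
  simp [qPochFin, Finset.prod_range_succ]

theorem qPochFin_add (c : ℂ) (m n : ℕ) :
    qPochFin q c (m + n) = qPochFin q c m * qPochFin q (c * (q : ℂ) ^ m) n := by
  simp [qPochFin, Finset.prod_range_add, pow_add, mul_assoc]

theorem qPochFin_zero_left (n : ℕ) : qPochFin q 0 n = 1 := by simp [qPochFin]

theorem norm_q (hq0 : 0 < q) : ‖(q : ℂ)‖ = q := by simp [abs_of_pos hq0]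

theorem q_ne_zero (hq0 : 0 < q) : (q : ℂ) ≠ 0 := by exact_mod_cast hq0.ne'

theorem summable_norm_mul_pow (hq0 : 0 < q) (hq1 : q < 1) (c : ℂ) :
    Summable fun n : ℕ => ‖-(c * (q : ℂ) ^ n)‖ := by
  simp only [norm_neg, norm_mul, norm_pow, norm_q hq0]
  exact (summable_geometric_of_lt_one hq0.le hq1).mul_left _

theorem tendsto_qPochFin (hq0 : 0 < q) (hq1 : q < 1) (c : ℂ) :
    Tendsto (qPochFin q c) atTop (𝓝 (qPoch q c)) := by
  have h := multipliable_one_add_of_summable (summable_norm_mul_pow hq0 hq1 c)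
  simp only [← sub_eq_add_neg] at h
  exact h.hasProd.tendsto_prod_nat

theorem qPoch_eq_qPochFin_mul (hq0 : 0 < q) (hq1 : q < 1) (c : ℂ) (n : ℕ) :
    qPoch q c = qPochFin q c n * qPoch q (c * (q : ℂ) ^ n) := by
  have h1 := (tendsto_qPochFin hq0 hq1 (c * (q : ℂ) ^ n)).const_mul (qPochFin q c n)
  have h2 : Tendsto (fun m => qPochFin q c (n + m)) atTop (𝓝 (qPoch q c)) := by
    simpa [add_comm] using (tendsto_add_atTop_iff_nat n).2 (tendsto_qPochFin hq0 hq1 c)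
  simp only [qPochFin_add] at h2
  exact tendsto_nhds_unique h2 h1

theorem qPoch_eq_one_sub_mul (hq0 : 0 < q) (hq1 : q < 1) (c : ℂ) :
    qPoch q c = (1 - c) * qPoch q (c * q) := by
  simpa [qPochFin] using qPoch_eq_qPochFin_mul hq0 hq1 c 1

theorem qPoch_zero : qPoch q 0 = 1 := by simp [qPoch]

theorem qPoch_ne_zero (hq0 : 0 < q) (hq1 : q < 1) {c : ℂ} (hc : ∀ n : ℕ, c * (q : ℂ) ^ n ≠ 1) :
    qPoch q c ≠ 0 := by
  have h := tprod_one_add_ne_zero_of_summable (f := fun n : ℕ => -(c * (q : ℂ) ^ n))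
    (fun n => by rw [← sub_eq_add_neg]; exact sub_ne_zero.2 (hc n).symm)
    (summable_norm_mul_pow hq0 hq1 c)
  simpa only [qPoch, sub_eq_add_neg] using h

theorem qPoch_ne_zero_of_norm_lt_one (hq0 : 0 < q) (hq1 : q < 1) {c : ℂ} (hc : ‖c‖ < 1) :
    qPoch q c ≠ 0 := by
  refine qPoch_ne_zero hq0 hq1 fun n h => ?_
  have h1 : ‖c * (q : ℂ) ^ n‖ < 1 := by
    rw [norm_mul, norm_pow, norm_q hq0]
    exact (mul_le_of_le_one_right (norm_nonneg _) (pow_le_one₀ hq0.le hq1.le)).trans_lt hc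
  rw [h] at h1
  simp at h1

theorem qPochFin_ne_zero {c : ℂ} (hc : ∀ n : ℕ, c * (q : ℂ) ^ n ≠ 1) (n : ℕ) :
    qPochFin q c n ≠ 0 :=
  Finset.prod_ne_zero_iff.2 fun k _ => sub_ne_zero.2 (hc k).symm

theorem one_sub_q_pow_ne_zero (hq0 : 0 < q) (hq1 : q < 1) (n : ℕ) :
    (1 : ℂ) - (q : ℂ) ^ (n + 1) ≠ 0 := by
  have : q ^ (n + 1) < 1 := pow_lt_one₀ hq0.le hq1 n.succ_ne_zero
  exact_mod_cast (sub_pos.2 this).ne'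

theorem qPochFin_self_ne_zero (hq0 : 0 < q) (hq1 : q < 1) (n : ℕ) :
    qPochFin q (q : ℂ) n ≠ 0 := by
  refine qPochFin_ne_zero (fun k h => one_sub_q_pow_ne_zero hq0 hq1 k ?_) n
  rw [pow_succ', h, sub_self]

theorem qPoch_self_ne_zero (hq0 : 0 < q) (hq1 : q < 1) : qPoch q (q : ℂ) ≠ 0 :=
  qPoch_ne_zero_of_norm_lt_one hq0 hq1 (by rwa [norm_q hq0])

theorem qPochFin_self_succ (n : ℕ) :
    qPochFin q (q : ℂ) (n + 1) = qPochFin q (q : ℂ) n * (1 - (q : ℂ) ^ (n + 1)) := by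
  rw [qPochFin_succ, pow_succ']

theorem exists_norm_le_of_tendsto {u : ℕ → ℂ} {l : ℂ} (h : Tendsto u atTop (𝓝 l)) :
    ∃ C : ℝ, 0 < C ∧ ∀ n, ‖u n‖ ≤ C := by
  obtain ⟨C, hC⟩ := (Metric.isBounded_range_of_tendsto u h).exists_norm_le
  exact ⟨max C 1, by positivity, fun n => (hC _ ⟨n, rfl⟩).trans (le_max_left _ _)⟩

theorem exists_norm_qPochFin_le (hq0 : 0 < q) (hq1 : q < 1) (c : ℂ) :
    ∃ C : ℝ, 0 < C ∧ ∀ n, ‖qPochFin q c n‖ ≤ C :=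
  exists_norm_le_of_tendsto (tendsto_qPochFin hq0 hq1 c)

theorem exists_norm_inv_qPochFin_self_le (hq0 : 0 < q) (hq1 : q < 1) :
    ∃ C : ℝ, 0 < C ∧ ∀ n, ‖(qPochFin q (q : ℂ) n)⁻¹‖ ≤ C :=
  exists_norm_le_of_tendsto ((tendsto_qPochFin hq0 hq1 q).inv₀ (qPoch_self_ne_zero hq0 hq1))

/-! ### Euler's series -/

theorem choose_two_succ (k : ℕ) : (k + 1).choose 2 = k.choose 2 + k := by
  rw [Nat.choose_succ_succ' k 1]; simp [add_comm]

theorem summable_pow_choose_two_mul_pow (hq0 : 0 < q) (hq1 : q < 1) (r : ℝ) :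
    Summable fun k : ℕ => q ^ (k.choose 2) * r ^ k := by
  refine summable_of_ratio_norm_eventually_le (r := 1 / 2) (by norm_num) ?_
  have h : Tendsto (fun k : ℕ => q ^ k * |r|) atTop (𝓝 (0 * |r|)) :=
    (tendsto_pow_atTop_nhds_zero_of_lt_one hq0.le hq1).mul_const _
  rw [zero_mul] at h
  filter_upwards [h.eventually_le_const (show (0 : ℝ) < 1 / 2 by norm_num)] with k hk
  rw [norm_mul, norm_mul, norm_pow, norm_pow, norm_pow, norm_pow, Real.norm_eq_abs,
    Real.norm_eq_abs, abs_of_pos hq0, choose_two_succ, pow_add, pow_succ]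
  calc q ^ k.choose 2 * q ^ k * (|r| ^ k * |r|) = (q ^ k * |r|) * (q ^ k.choose 2 * |r| ^ k) := by
        ring
    _ ≤ _ := by gcongr

/-- Lets a functional equation relating F(x) and F(qx) be iterated to the limit: F(x q^n) tends to
the constant coefficient. -/
theorem tendsto_tsum_mul_pow (hq0 : 0 < q) (hq1 : q < 1) {c : ℕ → ℂ}
    (hc : Summable fun k => ‖c k‖) :
    Tendsto (fun n : ℕ => ∑' k, c k * ((q : ℂ) ^ n) ^ k) atTop (𝓝 (c 0)) := by
  have h0 : ∑' k, (if k = 0 then c 0 else 0) = c 0 := by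
    rw [tsum_eq_single 0 (by intro k hk; simp [hk])]; simp
  rw [← h0]
  have hq : ‖(q : ℂ)‖ < 1 := by rwa [norm_q hq0]
  refine tendsto_tsum_of_dominated_convergence hc (fun k => ?_) (Eventually.of_forall fun n k => ?_)
  · rcases Nat.eq_zero_or_pos k with rfl | hk
    · simp
    · have := ((tendsto_pow_atTop_nhds_zero_of_norm_lt_one hq).pow k).const_mul (c k)
      simpa [hk.ne'] using this
  · rw [norm_mul, norm_pow, norm_pow]
    exact mul_le_of_le_one_right (norm_nonneg _)
      (pow_le_one₀ (by positivity) (pow_le_one₀ (norm_nonneg _) hq.le))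

theorem summable_norm_euler (hq0 : 0 < q) (hq1 : q < 1) (x : ℂ) :
    Summable fun k : ℕ => ‖(q : ℂ) ^ (k.choose 2) * x ^ k / qPochFin q (q : ℂ) k‖ := by
  obtain ⟨C, -, hC⟩ := exists_norm_inv_qPochFin_self_le hq0 hq1
  refine Summable.of_nonneg_of_le (fun _ => norm_nonneg _) (fun k => ?_)
    ((summable_pow_choose_two_mul_pow hq0 hq1 ‖x‖).mul_right C)
  rw [div_eq_mul_inv, norm_mul, norm_mul, norm_pow, norm_pow, norm_q hq0]
  gcongr
  exact hC k

theorem summable_norm_pow_div (hq0 : 0 < q) (hq1 : q < 1) {x : ℂ} (hx : ‖x‖ < 1) :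
    Summable fun k : ℕ => ‖x ^ k / qPochFin q (q : ℂ) k‖ := by
  obtain ⟨C, -, hC⟩ := exists_norm_inv_qPochFin_self_le hq0 hq1
  refine Summable.of_nonneg_of_le (fun _ => norm_nonneg _) (fun k => ?_)
    ((summable_geometric_of_lt_one (norm_nonneg x) hx).mul_right C)
  rw [div_eq_mul_inv, norm_mul, norm_pow]
  gcongr
  exact hC k

/-- Euler's expansion of `(-x; q)_∞`. -/
theorem tsum_euler (hq0 : 0 < q) (hq1 : q < 1) (x : ℂ) :
    ∑' k : ℕ, (q : ℂ) ^ (k.choose 2) * x ^ k / qPochFin q (q : ℂ) k = qPoch q (-x) := by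
  set F : ℂ → ℂ := fun x => ∑' k : ℕ, (q : ℂ) ^ (k.choose 2) * x ^ k / qPochFin q (q : ℂ) k with hF
  have hs : ∀ x : ℂ, Summable fun k : ℕ => (q : ℂ) ^ (k.choose 2) * x ^ k / qPochFin q (q : ℂ) k :=
    fun x => (summable_norm_euler hq0 hq1 x).of_norm
  have hfe : ∀ x : ℂ, F x = (1 + x) * F (x * q) := by
    intro x
    -- The factor 1 - q^(k+1) cancels the last factor of (q;q)_(k+1), and the new power q^k in the
    -- Gaussian exponent turns x^k into (xq)^k.
    have e : F x - F (x * q) = x * F (x * q) := by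
      simp only [hF]
      rw [← (hs x).tsum_sub (hs _), ← tsum_mul_left, ((hs x).sub (hs _)).tsum_eq_zero_add]
      simp only [pow_zero, sub_self, zero_add]
      refine tsum_congr fun k => ?_
      have h1 := qPochFin_self_ne_zero hq0 hq1 k
      have h2 := one_sub_q_pow_ne_zero hq0 hq1 k
      rw [qPochFin_self_succ, choose_two_succ]
      field_simp
      ring
    linear_combination e
  have hn : ∀ n : ℕ, F x = qPochFin q (-x) n * F (x * (q : ℂ) ^ n) := by
    intro n
    induction n with
    | zero => simp [qPochFin_zero]
    | succ n ih =>
      rw [ih, hfe, qPochFin_succ, pow_succ]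
      ring_nf
  have h1 := tendsto_tsum_mul_pow hq0 hq1 (summable_norm_euler hq0 hq1 x)
  have h2 := (tendsto_qPochFin hq0 hq1 (-x)).mul h1
  have h3 : (fun n : ℕ => qPochFin q (-x) n * ∑' k : ℕ, (q : ℂ) ^ (k.choose 2) * x ^ k /
      qPochFin q (q : ℂ) k * ((q : ℂ) ^ n) ^ k) = fun _ => F x := by
    funext n
    rw [hn n]
    congr 1
    refine tsum_congr fun k => ?_
    rw [mul_pow]; ring
  rw [h3] at h2
  have := tendsto_nhds_unique h2 tendsto_const_nhds
  simpa [qPochFin_zero] using this.symm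

/-- Euler's expansion of `1 / (x; q)_∞`. -/
theorem tsum_pow_div (hq0 : 0 < q) (hq1 : q < 1) {x : ℂ} (hx : ‖x‖ < 1) :
    ∑' k : ℕ, x ^ k / qPochFin q (q : ℂ) k = (qPoch q x)⁻¹ := by
  set F : ℂ → ℂ := fun x => ∑' k : ℕ, x ^ k / qPochFin q (q : ℂ) k with hF
  have hq : ∀ n : ℕ, ‖(q : ℂ) ^ n‖ ≤ 1 := fun n => by
    rw [norm_pow, norm_q hq0]; exact pow_le_one₀ hq0.le hq1.le
  have hxn : ∀ n : ℕ, ‖x * (q : ℂ) ^ n‖ < 1 := fun n => by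
    rw [norm_mul]; exact (mul_le_of_le_one_right (norm_nonneg _) (hq n)).trans_lt hx
  have hfe : ∀ y : ℂ, ‖y‖ < 1 → ‖y * q‖ < 1 → (1 - y) * F y = F (y * q) := by
    intro y hy hy'
    have s1 := (summable_norm_pow_div hq0 hq1 hy).of_norm
    have s2 := (summable_norm_pow_div hq0 hq1 hy').of_norm
    have e : F y - F (y * q) = y * F y := by
      simp only [hF]
      rw [← s1.tsum_sub s2, ← tsum_mul_left, (s1.sub s2).tsum_eq_zero_add]
      simp only [pow_zero, sub_self, zero_add]
      refine tsum_congr fun k => ?_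
      have h1 := qPochFin_self_ne_zero hq0 hq1 k
      have h2 := one_sub_q_pow_ne_zero hq0 hq1 k
      rw [qPochFin_self_succ]
      field_simp
      ring
    linear_combination e
  have hn : ∀ n : ℕ, qPochFin q x n * F x = F (x * (q : ℂ) ^ n) := by
    intro n
    induction n with
    | zero => simp [qPochFin_zero]
    | succ n ih =>
      have h := hxn (n + 1)
      rw [pow_succ, ← mul_assoc] at h
      rw [pow_succ, ← mul_assoc, ← hfe _ (hxn n) h, ← ih, qPochFin_succ]
      ring
  have h1 := tendsto_tsum_mul_pow hq0 hq1 (summable_norm_pow_div hq0 hq1 hx)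
  have h2 := (tendsto_qPochFin hq0 hq1 x).mul_const (F x)
  have h3 : (fun n : ℕ => ∑' k : ℕ, x ^ k / qPochFin q (q : ℂ) k * ((q : ℂ) ^ n) ^ k) =
      fun n => qPochFin q x n * F x := by
    funext n
    rw [hn n]
    refine tsum_congr fun k => ?_
    rw [mul_pow]; ring
  rw [h3] at h1
  have := tendsto_nhds_unique h2 h1
  rw [← one_div, eq_div_iff (qPoch_ne_zero_of_norm_lt_one hq0 hq1 hx), mul_comm]
  simpa [qPochFin_zero] using this

/-! ### Iterated `q`-differences and the `q`-binomial theorem -/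

/-- The Gauss expansion of the iterated `q`-difference `∏_{i < k} (T - β q^i)`. -/
theorem qDiff_expansion (hq0 : 0 < q) (hq1 : q < 1) (β : ℂ) {Y : ℕ → ℕ → ℂ}
    (hY : ∀ k m, Y (k + 1) m = Y k (m + 1) - β * (q : ℂ) ^ k * Y k m) (k m : ℕ) :
    Y k m / qPochFin q (q : ℂ) k = ∑ p ∈ Finset.HasAntidiagonal.antidiagonal k,
      (q : ℂ) ^ (p.1.choose 2) * (-β) ^ p.1 / qPochFin q (q : ℂ) p.1 *
        (Y 0 (p.2 + m) / qPochFin q (q : ℂ) p.2) := by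
  induction k generalizing m with
  | zero => simp [qPochFin_zero]
  | succ k ih =>
    have hk := one_sub_q_pow_ne_zero hq0 hq1 k
    have e1 : Y (k + 1) m / qPochFin q (q : ℂ) (k + 1) * (1 - (q : ℂ) ^ (k + 1)) =
        Y k (m + 1) / qPochFin q (q : ℂ) k - β * (q : ℂ) ^ k *
          (Y k m / qPochFin q (q : ℂ) k) := by
      have h1 := qPochFin_self_ne_zero hq0 hq1 k
      rw [qPochFin_self_succ, hY]
      field_simp
    refine mul_right_cancel₀ hk (e1.trans ?_)
    rw [ih, ih, Finset.sum_mul]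
    set t : ℕ × ℕ → ℂ := fun p => (q : ℂ) ^ (p.1.choose 2) * (-β) ^ p.1 / qPochFin q (q : ℂ) p.1 *
        (Y 0 (p.2 + m) / qPochFin q (q : ℂ) p.2) with ht
    -- For i + j = k + 1, split 1 - q^(i+j) = (1 - q^j) + q^j (1 - q^i). The first part lowers j and
    -- the second lowers i; these are the two terms of the recursion for Y.
    have e2 : ∑ p ∈ Finset.HasAntidiagonal.antidiagonal (k + 1), t p * (1 - (q : ℂ) ^ (k + 1)) =
        ∑ p ∈ Finset.HasAntidiagonal.antidiagonal (k + 1), t p * (1 - (q : ℂ) ^ p.2) +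
        ∑ p ∈ Finset.HasAntidiagonal.antidiagonal (k + 1),
          t p * ((q : ℂ) ^ p.2 * (1 - (q : ℂ) ^ p.1)) := by
      rw [← Finset.sum_add_distrib]
      refine Finset.sum_congr rfl fun p hp => ?_
      rw [← Finset.HasAntidiagonal.mem_antidiagonal.1 hp, pow_add]
      ring
    rw [e2, Finset.Nat.sum_antidiagonal_succ', Finset.Nat.sum_antidiagonal_succ]
    simp only [pow_zero, sub_self, mul_zero, zero_add]
    rw [sub_eq_add_neg, Finset.mul_sum, ← Finset.sum_neg_distrib]
    congr 1
    · refine Finset.sum_congr rfl fun p _ => ?_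
      have h1 := qPochFin_self_ne_zero hq0 hq1 p.2
      have h2 := one_sub_q_pow_ne_zero hq0 hq1 p.2
      have h3 := qPochFin_self_ne_zero hq0 hq1 p.1
      simp only [ht]
      rw [qPochFin_self_succ, show p.2 + 1 + m = p.2 + (m + 1) by ring]
      field_simp
    · refine Finset.sum_congr rfl fun p hp => ?_
      have h1 := qPochFin_self_ne_zero hq0 hq1 p.2
      have h2 := one_sub_q_pow_ne_zero hq0 hq1 p.1
      have h3 := qPochFin_self_ne_zero hq0 hq1 p.1
      simp only [ht]
      rw [qPochFin_self_succ, choose_two_succ, ← Finset.HasAntidiagonal.mem_antidiagonal.1 hp]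
      field_simp
      ring

theorem qDiff_term (hq0 : 0 < q) (hq1 : q < 1) (β x : ℂ) {Y : ℕ → ℕ → ℂ}
    (hY : ∀ k m, Y (k + 1) m = Y k (m + 1) - β * (q : ℂ) ^ k * Y k m) (k : ℕ) :
    x ^ k / qPochFin q (q : ℂ) k * Y k 0 = ∑ p ∈ Finset.HasAntidiagonal.antidiagonal k,
      (q : ℂ) ^ (p.1.choose 2) * (-(β * x)) ^ p.1 / qPochFin q (q : ℂ) p.1 *
        (x ^ p.2 / qPochFin q (q : ℂ) p.2 * Y 0 p.2) := by
  have h := qDiff_expansion hq0 hq1 β hY k 0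
  rw [div_mul_eq_mul_div, mul_div_assoc, h, Finset.mul_sum]
  refine Finset.sum_congr rfl fun p hp => ?_
  rw [← Finset.HasAntidiagonal.mem_antidiagonal.1 hp, pow_add, add_zero, ← neg_mul, mul_pow]
  ring

theorem summable_norm_qDiff (hq0 : 0 < q) (hq1 : q < 1) (β x : ℂ) {Y : ℕ → ℕ → ℂ}
    (hY : ∀ k m, Y (k + 1) m = Y k (m + 1) - β * (q : ℂ) ^ k * Y k m)
    (hs : Summable fun j : ℕ => ‖x ^ j / qPochFin q (q : ℂ) j * Y 0 j‖) :
    Summable fun k : ℕ => ‖x ^ k / qPochFin q (q : ℂ) k * Y k 0‖ := by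
  have h := summable_norm_sum_mul_antidiagonal_of_summable_norm
    (summable_norm_euler hq0 hq1 (-(β * x))) hs
  exact h.congr fun k => by rw [qDiff_term hq0 hq1 β x hY]

/-- The generating function of the iterated `q`-differences. -/
theorem tsum_qDiff (hq0 : 0 < q) (hq1 : q < 1) (β x : ℂ) {Y : ℕ → ℕ → ℂ}
    (hY : ∀ k m, Y (k + 1) m = Y k (m + 1) - β * (q : ℂ) ^ k * Y k m)
    (hs : Summable fun j : ℕ => ‖x ^ j / qPochFin q (q : ℂ) j * Y 0 j‖) :
    ∑' k : ℕ, x ^ k / qPochFin q (q : ℂ) k * Y k 0 =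
      qPoch q (β * x) * ∑' j : ℕ, x ^ j / qPochFin q (q : ℂ) j * Y 0 j := by
  have h := tsum_mul_tsum_eq_tsum_sum_antidiagonal_of_summable_norm
    (summable_norm_euler hq0 hq1 (-(β * x))) hs
  rw [tsum_euler hq0 hq1, neg_neg] at h
  rw [h]
  exact tsum_congr fun k => qDiff_term hq0 hq1 β x hY k

/-- The case of a trivial shift T = 1. It yields the q-binomial theorem and the Gauss expansion
behind Jackson's series. -/
theorem qPochFin_qDiff (b : ℂ) (k m : ℕ) :
    (fun k _ => qPochFin q b k : ℕ → ℕ → ℂ) (k + 1) m =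
      (fun k _ => qPochFin q b k : ℕ → ℕ → ℂ) k (m + 1) -
        b * (q : ℂ) ^ k * (fun k _ => qPochFin q b k : ℕ → ℕ → ℂ) k m := by
  simp only [qPochFin_succ]; ring

/-- The `q`-binomial theorem. -/
theorem tsum_qBinomial (hq0 : 0 < q) (hq1 : q < 1) (b : ℂ) {x : ℂ} (hx : ‖x‖ < 1) :
    ∑' k : ℕ, x ^ k / qPochFin q (q : ℂ) k * qPochFin q b k = qPoch q (b * x) / qPoch q x := by
  have h := tsum_qDiff hq0 hq1 b x (Y := fun k _ => qPochFin q b k) (qPochFin_qDiff b)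
    (by simpa [qPochFin_zero] using summable_norm_pow_div hq0 hq1 hx)
  simp only [qPochFin_zero, mul_one] at h
  rw [h, tsum_pow_div hq0 hq1 hx, div_eq_mul_inv]

/-! ### The theta function -/

/-- The triangular exponent `n (n - 1) / 2` for an integer `n`. -/
def tri (n : ℤ) : ℤ := n * (n - 1) / 2

theorem two_mul_tri (n : ℤ) : 2 * tri n = n * (n - 1) := by
  have h : Even (n * (n - 1)) := Int.even_mul_pred_self n
  exact Int.mul_ediv_cancel' h.two_dvd

theorem tri_add (m n : ℤ) : tri (m + n) = tri m + tri n + m * n := by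
  have h1 := two_mul_tri (m + n)
  have h2 := two_mul_tri m
  have h3 := two_mul_tri n
  linarith

theorem tri_natCast (k : ℕ) : tri k = k.choose 2 := by
  induction k with
  | zero => rfl
  | succ k ih =>
    have h1 := two_mul_tri (k + 1)
    have h2 := two_mul_tri k
    push_cast [choose_two_succ]
    linarith

theorem tri_neg (n : ℤ) : tri (-n) = tri n + n := by
  have h1 := two_mul_tri (-n)
  have h2 := two_mul_tri n
  linarith

theorem tri_zero : tri 0 = 0 := rfl

theorem tri_succ (n : ℤ) : tri (n + 1) = tri n + n := by
  rw [tri_add]; simp [tri]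

theorem mul_qTheta_mul_q (hq0 : 0 < q) (hq1 : q < 1) {τ : ℂ} (hτ : τ ≠ 0) :
    τ * qTheta q (q * τ) = qTheta q τ := by
  have hq := q_ne_zero hq0
  have e1 := qPoch_eq_one_sub_mul hq0 hq1 (-τ)
  have e2 := qPoch_eq_one_sub_mul hq0 hq1 (-((q : ℂ) / (q * τ)))
  have e3 : -((q : ℂ) / (q * τ)) * q = -(q / τ) := by field_simp
  have e4 : -τ * (q : ℂ) = -(q * τ) := by ring
  rw [e3] at e2
  rw [e4] at e1
  rw [qTheta, qTheta, e1, e2]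
  field_simp
  ring

theorem qTheta_zpow_mul (hq0 : 0 < q) (hq1 : q < 1) {τ : ℂ} (hτ : τ ≠ 0) (n : ℤ) :
    (q : ℂ) ^ tri n * τ ^ n * qTheta q ((q : ℂ) ^ n * τ) = qTheta q τ := by
  have hq := q_ne_zero hq0
  have step : ∀ m : ℤ, (q : ℂ) ^ tri (m + 1) * τ ^ (m + 1) * qTheta q ((q : ℂ) ^ (m + 1) * τ) =
      (q : ℂ) ^ tri m * τ ^ m * qTheta q ((q : ℂ) ^ m * τ) := by
    intro m
    rw [← mul_qTheta_mul_q hq0 hq1 (mul_ne_zero (zpow_ne_zero m hq) hτ), tri_succ,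
      zpow_add₀ hq, zpow_add₀ hτ, zpow_add₀ hq, zpow_one, zpow_one,
      show (q : ℂ) ^ m * q * τ = q * ((q : ℂ) ^ m * τ) by ring]
    ring
  induction n using Int.induction_on with
  | zero => simp [tri_zero]
  | succ n ih => rw [step, ih]
  | pred n ih => rw [← ih, ← step (-(n : ℤ) - 1), sub_add_cancel]

theorem qTheta_ne_zero (hq0 : 0 < q) (hq1 : q < 1) {τ : ℂ} (hτ : ∀ n : ℤ, τ ≠ -(q : ℂ) ^ n) :
    qTheta q τ ≠ 0 := by
  have hq := q_ne_zero hq0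
  refine mul_ne_zero (mul_ne_zero (qPoch_self_ne_zero hq0 hq1) ?_) ?_
  · refine qPoch_ne_zero hq0 hq1 fun n h => hτ (-n) ?_
    rw [zpow_neg, zpow_natCast]
    have := pow_ne_zero n hq
    field_simp
    linear_combination -h
  · refine qPoch_ne_zero hq0 hq1 fun n h => hτ (n + 1) ?_
    rcases eq_or_ne τ 0 with rfl | h0
    · simp at h
    rw [zpow_add₀ hq, zpow_natCast, zpow_one]
    field_simp at h
    linear_combination -h

theorem qTheta_div (τ : ℂ) (hq0 : 0 < q) : qTheta q ((q : ℂ) / τ) = qTheta q τ := by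
  have hq := q_ne_zero hq0
  rw [qTheta, qTheta, div_div_cancel₀ hq]
  ring

/-- Nonvanishing of theta is not needed: the two theta values vanish together, and then both sides
are 0. -/
theorem inv_qTheta_zpow_mul (hq0 : 0 < q) (hq1 : q < 1) {τ : ℂ} (hτ : τ ≠ 0) (n : ℤ) :
    (qTheta q ((q : ℂ) ^ n * τ))⁻¹ = (q : ℂ) ^ tri n * τ ^ n * (qTheta q τ)⁻¹ := by
  have hq := q_ne_zero hq0
  rw [← qTheta_zpow_mul hq0 hq1 hτ n]
  have h1 := zpow_ne_zero (tri n) hq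
  have h2 := zpow_ne_zero n hτ
  rw [mul_inv, ← mul_assoc, mul_inv_cancel₀ (mul_ne_zero h1 h2), one_mul]

theorem norm_zpow_q (hq0 : 0 < q) (n : ℤ) : ‖(q : ℂ) ^ n‖ = q ^ n := by
  rw [norm_zpow, norm_q hq0]

theorem summable_zpow_tri (hq0 : 0 < q) (hq1 : q < 1) (r : ℝ) :
    Summable fun n : ℤ => q ^ tri n * r ^ n := by
  refine Summable.of_nat_of_neg ?_ ?_
  · simpa [tri_natCast] using summable_pow_choose_two_mul_pow hq0 hq1 r
  · refine (summable_pow_choose_two_mul_pow hq0 hq1 (q / r)).congr fun k => ?_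
    rw [tri_neg, tri_natCast, zpow_add₀ hq0.ne', zpow_natCast, zpow_natCast, zpow_neg,
      zpow_natCast, div_pow]
    ring

theorem exists_zpow_tri_le (hq0 : 0 < q) (hq1 : q < 1) {r : ℝ} (hr : 0 < r) :
    ∃ C : ℝ, 0 ≤ C ∧ ∀ n : ℤ, q ^ tri n * r ^ n ≤ C :=
  ⟨∑' n : ℤ, q ^ tri n * r ^ n, tsum_nonneg fun n => by positivity, fun n =>
    (summable_zpow_tri hq0 hq1 r).le_tsum n fun m _ => by positivity⟩

/-! ### Bounds for infinite products -/

theorem qPochFin_self_eq_norm (hq0 : 0 < q) (hq1 : q < 1) (k : ℕ) :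
    qPochFin q (q : ℂ) k = (‖qPochFin q (q : ℂ) k‖ : ℂ) := by
  induction k with
  | zero => simp [qPochFin_zero]
  | succ k ih =>
    have h : (1 : ℂ) - (q : ℂ) ^ (k + 1) = (‖(1 : ℂ) - (q : ℂ) ^ (k + 1)‖ : ℂ) := by
      have h1 : 0 ≤ 1 - q ^ (k + 1) := sub_nonneg.2 (pow_le_one₀ hq0.le hq1.le)
      have h2 : (1 : ℂ) - (q : ℂ) ^ (k + 1) = ((1 - q ^ (k + 1) : ℝ) : ℂ) := by push_cast; rfl
      rw [h2, Complex.norm_real, Real.norm_eq_abs, abs_of_nonneg h1]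
    rw [qPochFin_self_succ, norm_mul, Complex.ofReal_mul, ← ih, ← h]

/-- Euler's series for (-x;q)_∞ has positive coefficients, so on a disc the modulus is largest at
the negative real boundary point. -/
theorem norm_qPoch_le (hq0 : 0 < q) (hq1 : q < 1) {x : ℂ} {r : ℝ} (hx : ‖x‖ ≤ r) :
    ‖qPoch q x‖ ≤ ‖qPoch q (-(r : ℂ))‖ := by
  have hr : 0 ≤ r := (norm_nonneg x).trans hx
  have e : ∀ k : ℕ, (q : ℂ) ^ (k.choose 2) * (r : ℂ) ^ k / qPochFin q (q : ℂ) k =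
      ((‖(q : ℂ) ^ (k.choose 2) * (r : ℂ) ^ k / qPochFin q (q : ℂ) k‖ : ℝ) : ℂ) := by
    intro k
    rw [norm_div, norm_mul, norm_pow, norm_pow, norm_q hq0, Complex.norm_real, Real.norm_eq_abs,
      abs_of_nonneg hr]
    push_cast
    rw [← qPochFin_self_eq_norm hq0 hq1]
  have h1 : ‖qPoch q (-(r : ℂ))‖ =
      ∑' k : ℕ, ‖(q : ℂ) ^ (k.choose 2) * (r : ℂ) ^ k / qPochFin q (q : ℂ) k‖ := by
    rw [← tsum_euler hq0 hq1, tsum_congr e, ← Complex.ofReal_tsum, Complex.norm_real,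
      Real.norm_eq_abs, abs_of_nonneg (tsum_nonneg fun _ => norm_nonneg _)]
  have h2 := tsum_euler hq0 hq1 (-x)
  rw [neg_neg] at h2
  rw [h1, ← h2]
  refine (norm_tsum_le_tsum_norm (summable_norm_euler hq0 hq1 (-x))).trans
    ((summable_norm_euler hq0 hq1 (-x)).tsum_le_tsum (fun k => ?_) (summable_norm_euler hq0 hq1 r))
  rw [norm_div, norm_div, norm_mul, norm_mul, norm_pow (-x), norm_pow (r : ℂ), norm_neg,
    Complex.norm_real, Real.norm_eq_abs, abs_of_nonneg hr]
  gcongr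

theorem one_le_norm_qPoch (hq0 : 0 < q) (hq1 : q < 1) {r : ℝ} (hr : 0 ≤ r) :
    1 ≤ ‖qPoch q (-(r : ℂ))‖ := by
  have h := norm_qPoch_le hq0 hq1 (x := 0) (r := r) (by simpa using hr)
  rwa [qPoch_zero, norm_one] at h

/-- With ρ = s‖λ‖, the product is dominated by (-q^m ρ;q)_∞, hence by θ_q(q^m ρ)/(q;q)_∞, since the
remaining theta factor is at least 1; quasi-periodicity then gives the rate. A separate s > 0 keeps
ρ nonzero when b = 0. -/
theorem exists_norm_qPoch_zpow_le (hq0 : 0 < q) (hq1 : q < 1) {lam : ℂ} (hlam : lam ≠ 0) {b : ℂ}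
    {s : ℝ} (hs : 0 < s) (hb : ‖b‖ ≤ s) :
    ∃ C : ℝ, 0 ≤ C ∧ ∀ m : ℤ,
      ‖qPoch q (-(b * (q : ℂ) ^ m * lam))‖ ≤ C * (q ^ tri m * (s * ‖lam‖) ^ m)⁻¹ := by
  set ρ : ℝ := s * ‖lam‖ with hρ
  have hρ0 : 0 < ρ := mul_pos hs (norm_pos_iff.2 hlam)
  have hρc : (ρ : ℂ) ≠ 0 := by exact_mod_cast hρ0.ne'
  refine ⟨‖qTheta q ρ‖ / ‖qPoch q (q : ℂ)‖, by positivity, fun m => ?_⟩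
  have hm : 0 < q ^ m * ρ := mul_pos (zpow_pos hq0 m) hρ0
  have h1 : ‖qPoch q (-(b * (q : ℂ) ^ m * lam))‖ ≤ ‖qPoch q (-((q ^ m * ρ : ℝ) : ℂ))‖ := by
    refine norm_qPoch_le hq0 hq1 ?_
    rw [norm_neg, norm_mul, norm_mul, norm_zpow_q hq0, hρ]
    have : 0 < q ^ m := zpow_pos hq0 m
    calc ‖b‖ * q ^ m * ‖lam‖ ≤ s * q ^ m * ‖lam‖ := by gcongr
      _ = _ := by ring
  refine h1.trans ?_
  have h2 : ‖qTheta q ((q : ℂ) ^ m * ρ)‖ =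
      ‖qPoch q (q : ℂ)‖ * ‖qPoch q (-((q ^ m * ρ : ℝ) : ℂ))‖ *
        ‖qPoch q (-((q / (q ^ m * ρ) : ℝ) : ℂ))‖ := by
    rw [qTheta, norm_mul, norm_mul]
    push_cast
    rfl
  have h3 := one_le_norm_qPoch hq0 hq1 (div_pos hq0 hm).le
  have h4 : 0 < ‖qPoch q (q : ℂ)‖ := norm_pos_iff.2 (qPoch_self_ne_zero hq0 hq1)
  have h5 := congrArg norm (qTheta_zpow_mul hq0 hq1 hρc m)
  rw [norm_mul, norm_mul, norm_zpow_q hq0, norm_zpow, Complex.norm_real, Real.norm_eq_abs,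
    abs_of_pos hρ0] at h5
  have h6 : 0 < q ^ tri m * ρ ^ m := mul_pos (zpow_pos hq0 _) (zpow_pos hρ0 _)
  rw [← h5, h2, div_mul_eq_mul_div, le_div_iff₀ h4, mul_comm (q ^ tri m * ρ ^ m),
    mul_assoc _ _ (_)⁻¹,
    mul_inv_cancel₀ h6.ne', mul_one, mul_comm ‖qPoch q (q : ℂ)‖]
  exact le_mul_of_one_le_right (by positivity) h3

theorem zpow_mul_pow_ne_one (hq0 : 0 < q) {lam : ℂ}
    (hlam : ∀ n : ℤ, lam ≠ -(q : ℂ) ^ n) (m : ℤ) (n : ℕ) :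
    -((q : ℂ) ^ m * lam) * (q : ℂ) ^ n ≠ 1 := by
  intro h
  have hq := q_ne_zero hq0
  apply hlam (-(m + n))
  have h1 := zpow_ne_zero m hq
  have h2 := pow_ne_zero n hq
  rw [zpow_neg, zpow_add₀ hq, zpow_natCast]
  field_simp
  linear_combination -h

theorem qPoch_zpow_ne_zero (hq0 : 0 < q) (hq1 : q < 1) {lam : ℂ}
    (hlam : ∀ n : ℤ, lam ≠ -(q : ℂ) ^ n) (m : ℤ) : qPoch q (-((q : ℂ) ^ m * lam)) ≠ 0 :=
  qPoch_ne_zero hq0 hq1 fun n => zpow_mul_pow_ne_one hq0 hlam m n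

/-- For m ≥ 0 the reciprocal is (-λ;q)_m/(-λ;q)_∞, and the finite products converge. -/
theorem exists_norm_inv_qPoch_le_of_nonneg (hq0 : 0 < q) (hq1 : q < 1) {lam : ℂ}
    (hlam : ∀ n : ℤ, lam ≠ -(q : ℂ) ^ n) :
    ∃ C : ℝ, 0 ≤ C ∧ ∀ m : ℤ, 0 ≤ m → ‖(qPoch q (-((q : ℂ) ^ m * lam)))⁻¹‖ ≤ C := by
  obtain ⟨C, hC0, hC⟩ := exists_norm_qPochFin_le hq0 hq1 (-lam)
  refine ⟨C * ‖(qPoch q (-lam))⁻¹‖, by positivity, fun m hm => ?_⟩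
  lift m to ℕ using hm
  have h0 : qPoch q (-lam) ≠ 0 := by simpa using qPoch_zpow_ne_zero hq0 hq1 hlam 0
  have h1 := qPoch_eq_qPochFin_mul hq0 hq1 (-lam) m
  have h2 : -((q : ℂ) ^ (m : ℤ) * lam) = -lam * (q : ℂ) ^ m := by rw [zpow_natCast]; ring
  have h3 : (qPoch q (-lam * (q : ℂ) ^ m))⁻¹ = qPochFin q (-lam) m * (qPoch q (-lam))⁻¹ := by
    have h4 : qPochFin q (-lam) m ≠ 0 := left_ne_zero_of_mul (h1 ▸ h0)
    rw [h1, mul_inv, mul_inv_cancel_left₀ h4]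
  rw [h2, h3, norm_mul]
  gcongr
  exact hC m

/-- The reciprocal equals (q;q)_∞ (-q^(1-m)/λ;q)_∞/θ_q(q^m λ). For m ≤ 0 the numerator stays bounded
and theta supplies the Gaussian decay. -/
theorem exists_norm_inv_qPoch_le_of_nonpos (hq0 : 0 < q) (hq1 : q < 1) {lam : ℂ} (hlam0 : lam ≠ 0)
    (hlam : ∀ n : ℤ, lam ≠ -(q : ℂ) ^ n) :
    ∃ C : ℝ, 0 ≤ C ∧ ∀ m : ℤ, m ≤ 0 →
      ‖(qPoch q (-((q : ℂ) ^ m * lam)))⁻¹‖ ≤ C * (q ^ tri m * ‖lam‖ ^ m) := by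
  have hq := q_ne_zero hq0
  have hl : 0 < ‖lam‖ := norm_pos_iff.2 hlam0
  refine ⟨‖qPoch q (q : ℂ)‖ * ‖qPoch q (-((q / ‖lam‖ : ℝ) : ℂ))‖ * ‖(qTheta q lam)⁻¹‖,
    by positivity, fun m hm => ?_⟩
  have e := qTheta_zpow_mul hq0 hq1 hlam0 m
  have hθ := qTheta_ne_zero hq0 hq1 hlam
  have hT : qTheta q ((q : ℂ) ^ m * lam) ≠ 0 := right_ne_zero_of_mul (e ▸ hθ)
  have h0 : qPoch q (-((q : ℂ) / ((q : ℂ) ^ m * lam))) ≠ 0 := right_ne_zero_of_mul hT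
  have h1 := qPoch_self_ne_zero hq0 hq1
  have h2 : (qPoch q (-((q : ℂ) ^ m * lam)))⁻¹ = qPoch q (q : ℂ) *
      qPoch q (-((q : ℂ) / ((q : ℂ) ^ m * lam))) *
        ((q : ℂ) ^ tri m * lam ^ m * (qTheta q lam)⁻¹) := by
    rw [← inv_qTheta_zpow_mul hq0 hq1 hlam0 m, qTheta, mul_inv, mul_inv]
    field_simp
  have h3 : ‖qPoch q (-((q : ℂ) / ((q : ℂ) ^ m * lam)))‖ ≤
      ‖qPoch q (-((q / ‖lam‖ : ℝ) : ℂ))‖ := by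
    refine norm_qPoch_le hq0 hq1 ?_
    rw [norm_neg, norm_div, norm_mul, norm_zpow_q hq0, norm_q hq0]
    have : 1 ≤ q ^ m := by
      simpa using zpow_le_zpow_right_of_le_one₀ hq0 hq1.le hm
    gcongr
    exact le_mul_of_one_le_left hl.le this
  rw [h2, norm_mul, norm_mul, norm_mul, norm_mul, norm_zpow_q hq0, norm_zpow]
  have := zpow_pos hq0 (tri m)
  calc _ ≤ ‖qPoch q (q : ℂ)‖ * ‖qPoch q (-((q / ‖lam‖ : ℝ) : ℂ))‖ *
        (q ^ tri m * ‖lam‖ ^ m * ‖(qTheta q lam)⁻¹‖) := by gcongr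
    _ = _ := by ring

/-- Gaussian decay at -∞ beats every geometric rate, so R ≥ 1 is arbitrary. A bound multiplicative
in m separates n and k once m = n - k. -/
theorem exists_norm_inv_qPoch_le (hq0 : 0 < q) (hq1 : q < 1) {lam : ℂ} (hlam0 : lam ≠ 0)
    (hlam : ∀ n : ℤ, lam ≠ -(q : ℂ) ^ n) {R : ℝ} (hR : 1 ≤ R) :
    ∃ C : ℝ, 0 ≤ C ∧ ∀ m : ℤ, ‖(qPoch q (-((q : ℂ) ^ m * lam)))⁻¹‖ ≤ C * R ^ m := by
  have hl : 0 < ‖lam‖ := norm_pos_iff.2 hlam0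
  have hR0 : 0 < R := by linarith
  obtain ⟨C₁, hC₁, h₁⟩ := exists_norm_inv_qPoch_le_of_nonneg hq0 hq1 hlam
  obtain ⟨C₂, hC₂, h₂⟩ := exists_norm_inv_qPoch_le_of_nonpos hq0 hq1 hlam0 hlam
  obtain ⟨C₃, hC₃, h₃⟩ := exists_zpow_tri_le hq0 hq1 (div_pos hl hR0)
  refine ⟨C₁ + C₂ * C₃, by positivity, fun m => ?_⟩
  have hRm : 0 < R ^ m := zpow_pos hR0 m
  rcases le_total 0 m with hm | hm
  · have : 1 ≤ R ^ m := one_le_zpow₀ hR hm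
    calc _ ≤ C₁ := h₁ m hm
      _ ≤ C₁ * R ^ m := le_mul_of_one_le_right hC₁ this
      _ ≤ _ := by gcongr; exact le_add_of_nonneg_right (by positivity)
  · have h4 := h₃ m
    rw [div_zpow, ← mul_div_assoc, div_le_iff₀ hRm] at h4
    calc _ ≤ C₂ * (q ^ tri m * ‖lam‖ ^ m) := h₂ m hm
      _ ≤ C₂ * (C₃ * R ^ m) := by gcongr
      _ ≤ _ := by rw [add_mul, mul_assoc]; exact le_add_of_nonneg_left (by positivity)

theorem norm_qPoch_zpow_le_of_nonneg (hq0 : 0 < q) (hq1 : q < 1) (c lam : ℂ) {m : ℤ} (hm : 0 ≤ m) :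
    ‖qPoch q (-(c * (q : ℂ) ^ m * lam))‖ ≤ ‖qPoch q (-((‖c‖ * ‖lam‖ : ℝ) : ℂ))‖ := by
  refine norm_qPoch_le hq0 hq1 ?_
  rw [norm_neg, norm_mul, norm_mul, norm_zpow_q hq0]
  have : q ^ m ≤ 1 := by simpa using zpow_le_zpow_right_of_le_one₀ hq0 hq1.le hm
  gcongr
  exact mul_le_of_le_one_right (norm_nonneg _) this

/-- As m → -∞ the Gaussian factors of numerator and denominator cancel, leaving s₂^(-m). For m ≥ 0
the quotient is bounded, and s₁ ≤ 1 gives s₁^(-m) ≥ 1. Both rates stay free, to be tuned in the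
double series. -/
theorem exists_norm_qPoch_div_le (hq0 : 0 < q) (hq1 : q < 1) {lam : ℂ} (hlam0 : lam ≠ 0)
    (hlam : ∀ n : ℤ, lam ≠ -(q : ℂ) ^ n) (b : ℂ) {s₁ s₂ : ℝ} (hs₁ : 0 < s₁) (hs₁' : s₁ ≤ 1)
    (hs₂ : 0 < s₂) (hb : ‖b‖ ≤ s₂) :
    ∃ C : ℝ, 0 ≤ C ∧ ∀ m : ℤ, ‖qPoch q (-(b * (q : ℂ) ^ m * lam)) /
      qPoch q (-((q : ℂ) ^ m * lam))‖ ≤ C * ((s₁⁻¹) ^ m + (s₂⁻¹) ^ m) := by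
  have hl : 0 < ‖lam‖ := norm_pos_iff.2 hlam0
  obtain ⟨C₁, hC₁, h₁⟩ := exists_norm_inv_qPoch_le_of_nonneg hq0 hq1 hlam
  obtain ⟨C₂, hC₂, h₂⟩ := exists_norm_inv_qPoch_le_of_nonpos hq0 hq1 hlam0 hlam
  obtain ⟨C₃, hC₃, h₃⟩ := exists_norm_qPoch_zpow_le hq0 hq1 hlam0 hs₂ hb
  set M := ‖qPoch q (-((‖b‖ * ‖lam‖ : ℝ) : ℂ))‖ with hM
  have hM0 : 0 ≤ M := norm_nonneg _
  refine ⟨M * C₁ + C₃ * C₂, by positivity, fun m => ?_⟩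
  have hp₁ : 0 < (s₁⁻¹) ^ m := zpow_pos (inv_pos.2 hs₁) m
  have hp₂ : 0 < (s₂⁻¹) ^ m := zpow_pos (inv_pos.2 hs₂) m
  rw [div_eq_mul_inv, norm_mul]
  rcases le_total 0 m with hm | hm
  · have h4 : 1 ≤ (s₁⁻¹) ^ m := one_le_zpow₀ ((one_le_inv₀ hs₁).2 hs₁') hm
    calc _ ≤ M * C₁ := by gcongr; exacts [norm_qPoch_zpow_le_of_nonneg hq0 hq1 b lam hm, h₁ m hm]
      _ ≤ M * C₁ * ((s₁⁻¹) ^ m + (s₂⁻¹) ^ m) :=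
        le_mul_of_one_le_right (by positivity) (by linarith)
      _ ≤ _ := by gcongr; exact le_add_of_nonneg_right (by positivity)
  · have ht : 0 < q ^ tri m := zpow_pos hq0 _
    have hlm : 0 < ‖lam‖ ^ m := zpow_pos hl _
    have hsm : 0 < s₂ ^ m := zpow_pos hs₂ _
    calc _ ≤ (C₃ * (q ^ tri m * (s₂ * ‖lam‖) ^ m)⁻¹) * (C₂ * (q ^ tri m * ‖lam‖ ^ m)) :=
          mul_le_mul (h₃ m) (h₂ m hm) (norm_nonneg _) (by positivity)
      _ = C₃ * C₂ * (s₂⁻¹) ^ m := by rw [mul_zpow, inv_zpow]; field_simp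
      _ ≤ C₃ * C₂ * ((s₁⁻¹) ^ m + (s₂⁻¹) ^ m) := by gcongr; linarith
      _ ≤ _ := by gcongr; exact le_add_of_nonneg_left (by positivity)

/-! ### The weights of the discrete `q`-Laplace transform -/

theorem inv_qTheta_weight (hq0 : 0 < q) (hq1 : q < 1) {lam z : ℂ} (hlam0 : lam ≠ 0) (hz0 : z ≠ 0)
    (n : ℤ) : (qTheta q ((q : ℂ) ^ n * lam / z))⁻¹ =
      (q : ℂ) ^ tri n * (lam / z) ^ n * (qTheta q (lam / z))⁻¹ := by
  rw [mul_div_assoc, inv_qTheta_zpow_mul hq0 hq1 (div_ne_zero hlam0 hz0)]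

theorem norm_inv_qTheta_weight (hq0 : 0 < q) (hq1 : q < 1) {lam z : ℂ} (hlam0 : lam ≠ 0)
    (hz0 : z ≠ 0) (n : ℤ) : ‖(qTheta q ((q : ℂ) ^ n * lam / z))⁻¹‖ =
      q ^ tri n * (‖lam‖ / ‖z‖) ^ n * ‖(qTheta q (lam / z))⁻¹‖ := by
  rw [inv_qTheta_weight hq0 hq1 hlam0 hz0, norm_mul, norm_mul, norm_zpow_q hq0, norm_zpow, norm_div]

/-- Multiplication by `q^(k choose 2) t^k` shifts the weights. -/
theorem weight_mul_pow (hq0 : 0 < q) (hq1 : q < 1) {lam z : ℂ} (hlam0 : lam ≠ 0) (hz0 : z ≠ 0)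
    (n : ℤ) (k : ℕ) : (q : ℂ) ^ (k.choose 2) * ((q : ℂ) ^ n * lam) ^ k *
      (qTheta q ((q : ℂ) ^ n * lam / z))⁻¹ =
        z ^ k * (qTheta q ((q : ℂ) ^ (n + k) * lam / z))⁻¹ := by
  have hq := q_ne_zero hq0
  rw [inv_qTheta_weight hq0 hq1 hlam0 hz0, inv_qTheta_weight hq0 hq1 hlam0 hz0, tri_add,
    tri_natCast, zpow_add₀ hq, zpow_add₀ hq, zpow_add₀ (div_ne_zero hlam0 hz0), zpow_mul,
    zpow_natCast, zpow_natCast, zpow_natCast, mul_pow, div_pow]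
  field_simp

theorem summable_weight (hq0 : 0 < q) (hq1 : q < 1) {lam z : ℂ} (hlam0 : lam ≠ 0)
    (hz0 : z ≠ 0) (r : ℝ) :
    Summable fun n : ℤ => ‖(qTheta q ((q : ℂ) ^ n * lam / z))⁻¹‖ * r ^ n := by
  refine ((summable_zpow_tri hq0 hq1 (‖lam‖ / ‖z‖ * r)).mul_right
    ‖(qTheta q (lam / z))⁻¹‖).congr fun n => ?_
  rw [norm_inv_qTheta_weight hq0 hq1 hlam0 hz0, mul_zpow]
  ring

/-- At +∞ the weight alone suffices. At -∞ its Gaussian decay is cancelled by the growth of the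
product, and the geometric ratio s‖z‖/R remains. -/
theorem summable_weight_mul_qPoch (hq0 : 0 < q) (hq1 : q < 1) {lam z : ℂ} (hlam0 : lam ≠ 0)
    (hz0 : z ≠ 0) {b : ℂ} {s R : ℝ} (hs : 0 < s) (hb : ‖b‖ ≤ s) (hR : s * ‖z‖ < R) :
    Summable fun n : ℤ => ‖(qTheta q ((q : ℂ) ^ n * lam / z))⁻¹‖ * R ^ n *
      ‖qPoch q (-(b * (q : ℂ) ^ n * lam))‖ := by
  have hl : 0 < ‖lam‖ := norm_pos_iff.2 hlam0
  have hz : 0 < ‖z‖ := norm_pos_iff.2 hz0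
  have hR0 : 0 < R := (mul_pos hs hz).trans hR
  refine Summable.of_nat_of_neg ?_ ?_
  · refine Summable.of_nonneg_of_le (fun n => by positivity) (fun n => ?_)
      (((summable_weight hq0 hq1 hlam0 hz0 R).comp_injective Nat.cast_injective).mul_right
        ‖qPoch q (-((‖b‖ * ‖lam‖ : ℝ) : ℂ))‖)
    exact mul_le_mul_of_nonneg_left
      (norm_qPoch_zpow_le_of_nonneg hq0 hq1 b lam (Int.natCast_nonneg n)) (by positivity)
  · obtain ⟨C, hC0, hC⟩ := exists_norm_qPoch_zpow_le hq0 hq1 hlam0 hs hb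
    have hg : s * ‖z‖ / R < 1 := (div_lt_one hR0).2 hR
    refine Summable.of_nonneg_of_le (fun n => by positivity) (fun n => ?_)
      ((summable_geometric_of_lt_one (by positivity) hg).mul_left (‖(qTheta q (lam / z))⁻¹‖ * C))
    refine (mul_le_mul_of_nonneg_left (hC _) (by positivity)).trans_eq ?_
    have h1 := (zpow_pos hq0 (tri (-(n : ℤ)))).ne'
    rw [norm_inv_qTheta_weight hq0 hq1 hlam0 hz0, zpow_neg, zpow_neg, zpow_neg, zpow_natCast,
      zpow_natCast, zpow_natCast, div_pow, div_pow, mul_pow, mul_pow]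
    field_simp

/-! ### Partial fractions -/

/-- The coefficients `∏_{i < m} (c - q^(i+1)) = c^m (q/c; q)_m` of the partial fraction expansion of
`(-ct; q)_∞ / (-t; q)_∞`. -/
noncomputable def pfCoeff (q : ℝ) (c : ℂ) (m : ℕ) : ℂ :=
  ∏ i ∈ Finset.range m, (c - (q : ℂ) ^ (i + 1))

theorem pfCoeff_zero (c : ℂ) : pfCoeff q c 0 = 1 := by simp [pfCoeff]

theorem pfCoeff_succ (c : ℂ) (m : ℕ) :
    pfCoeff q c (m + 1) = pfCoeff q c m * (c - (q : ℂ) ^ (m + 1)) := by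
  simp [pfCoeff, Finset.prod_range_succ]

/-- Here the shift T is multiplication by c, and β = q. The generating function is therefore
(qx;q)_∞/(cx;q)_∞ for ‖cx‖ < 1, used below at x = 1. -/
theorem pfCoeff_qDiff (c : ℂ) (k m : ℕ) :
    (fun k j => c ^ j * pfCoeff q c k : ℕ → ℕ → ℂ) (k + 1) m =
      (fun k j => c ^ j * pfCoeff q c k : ℕ → ℕ → ℂ) k (m + 1) -
        (q : ℂ) * (q : ℂ) ^ k * (fun k j => c ^ j * pfCoeff q c k : ℕ → ℕ → ℂ) k m := by
  simp only [pfCoeff_succ]; ring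

theorem summable_norm_pfCoeff_aux (hq0 : 0 < q) (hq1 : q < 1) {c x : ℂ} (hx : ‖c * x‖ < 1) :
    Summable fun j : ℕ => ‖x ^ j / qPochFin q (q : ℂ) j * (c ^ j * pfCoeff q c 0)‖ := by
  refine (summable_norm_pow_div hq0 hq1 hx).congr fun j => ?_
  rw [pfCoeff_zero, mul_pow]; ring_nf

theorem summable_norm_pfCoeff (hq0 : 0 < q) (hq1 : q < 1) {c x : ℂ} (hx : ‖c * x‖ < 1) :
    Summable fun k : ℕ => ‖x ^ k / qPochFin q (q : ℂ) k * pfCoeff q c k‖ := by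
  simpa using summable_norm_qDiff hq0 hq1 q x (Y := fun k j => c ^ j * pfCoeff q c k)
    (pfCoeff_qDiff c) (summable_norm_pfCoeff_aux hq0 hq1 hx)

theorem summable_norm_pfCoeff_div (hq0 : 0 < q) (hq1 : q < 1) {c : ℂ} (hc : ‖c‖ < 1) :
    Summable fun k : ℕ => ‖pfCoeff q c k / qPochFin q (q : ℂ) k‖ := by
  refine (summable_norm_pfCoeff hq0 hq1 (x := 1) (by simpa using hc)).congr fun k => ?_
  rw [one_pow]; ring_nf

theorem tsum_pfCoeff (hq0 : 0 < q) (hq1 : q < 1) {c : ℂ} (hc : ‖c‖ < 1) :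
    ∑' k : ℕ, pfCoeff q c k / qPochFin q (q : ℂ) k = qPoch q (q : ℂ) / qPoch q c := by
  have h := tsum_qDiff hq0 hq1 q 1 (Y := fun k j => c ^ j * pfCoeff q c k)
    (pfCoeff_qDiff c) (summable_norm_pfCoeff_aux hq0 hq1 (by simpa using hc))
  rw [mul_one] at h
  rw [div_eq_mul_inv, ← tsum_pow_div hq0 hq1 hc]
  calc _ = _ := tsum_congr fun k => by rw [one_pow, pow_zero]; ring
    _ = _ := h
    _ = _ := by congr 1; exact tsum_congr fun k => by rw [one_pow, pfCoeff_zero]; ring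

/-- The sequence tends to 1, hence is bounded. A vanishing denominator is harmless because its
inverse is 0 by convention. -/
theorem exists_norm_inv_one_add_le (hq0 : 0 < q) (hq1 : q < 1) (t : ℂ) :
    ∃ C : ℝ, 0 < C ∧ ∀ n : ℕ, ‖(1 + t * (q : ℂ) ^ n)⁻¹‖ ≤ C := by
  have h : Tendsto (fun n : ℕ => (1 + t * (q : ℂ) ^ n)⁻¹) atTop (𝓝 (1 + t * 0)⁻¹) := by
    have hq : ‖(q : ℂ)‖ < 1 := by rwa [norm_q hq0]
    exact (((tendsto_pow_atTop_nhds_zero_of_norm_lt_one hq).const_mul t).const_add 1).inv₀ (by simp)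
  exact exists_norm_le_of_tendsto h

theorem summable_norm_partialFraction (hq0 : 0 < q) (hq1 : q < 1) {c : ℂ} (hc : ‖c‖ < 1) (t : ℂ) :
    Summable fun m : ℕ =>
      ‖pfCoeff q c m / qPochFin q (q : ℂ) m * (1 + t * (q : ℂ) ^ m)⁻¹‖ := by
  obtain ⟨C, -, hC⟩ := exists_norm_inv_one_add_le hq0 hq1 t
  refine Summable.of_nonneg_of_le (fun _ => norm_nonneg _) (fun m => ?_)
    ((summable_norm_pfCoeff_div hq0 hq1 hc).mul_right C)
  rw [norm_mul]
  gcongr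
  exact hC m

/-- Both sides satisfy (1+u)S(u) = (1+cu)S(qu). Iterating towards 0 reduces the identity to the
value S(0), which is `tsum_pfCoeff`. -/
theorem tsum_partialFraction (hq0 : 0 < q) (hq1 : q < 1) {c : ℂ} (hc : ‖c‖ < 1) {t : ℂ}
    (ht : ∀ n : ℕ, -t * (q : ℂ) ^ n ≠ 1) :
    ∑' m : ℕ, pfCoeff q c m / qPochFin q (q : ℂ) m * (1 + t * (q : ℂ) ^ m)⁻¹ =
      qPoch q (q : ℂ) / qPoch q c * (qPoch q (-(c * t)) / qPoch q (-t)) := by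
  set d : ℕ → ℂ := fun m => pfCoeff q c m / qPochFin q (q : ℂ) m with hd
  set S : ℂ → ℂ := fun t => ∑' m : ℕ, d m * (1 + t * (q : ℂ) ^ m)⁻¹ with hS
  have hdn : Summable fun m => ‖d m‖ := summable_norm_pfCoeff_div hq0 hq1 hc
  have hds : Summable d := hdn.of_norm
  have hss : ∀ t : ℂ, Summable fun m : ℕ => d m * (1 + t * (q : ℂ) ^ m)⁻¹ :=
    fun t => (summable_norm_partialFraction hq0 hq1 hc t).of_norm
  have hne : ∀ n : ℕ, 1 + t * (q : ℂ) ^ n ≠ 0 := fun n h => ht n (by linear_combination -h)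
  have hdr : ∀ m, d (m + 1) * (1 - (q : ℂ) ^ (m + 1)) = d m * (c - (q : ℂ) ^ (m + 1)) := by
    intro m
    have h1 := qPochFin_self_ne_zero hq0 hq1 m
    have h2 := one_sub_q_pow_ne_zero hq0 hq1 m
    simp only [hd]
    rw [pfCoeff_succ, qPochFin_self_succ]
    field_simp
  have hfe : ∀ u : ℂ, (∀ n : ℕ, 1 + u * (q : ℂ) ^ n ≠ 0) →
      (1 + u) * S u = (1 + c * u) * S (u * q) := by
    intro u hu
    have s1 := ((hss u).mul_left (1 + u)).sub hds
    have s2 := ((hss (u * q)).mul_left (1 + c * u)).sub hds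
    -- After subtracting Σ d_m the terms are u d_m (1-q^m)/(1+uq^m) and u d_m
    -- (c-q^(m+1))/(1+uq^(m+1)). The first vanishes at m = 0, and the recursion for d matches the
    -- rest after a shift by one.
    have e1 : (1 + u) * S u - ∑' m, d m = (1 + c * u) * S (u * q) - ∑' m, d m := by
      simp only [hS]
      rw [← tsum_mul_left, ← tsum_mul_left, ← ((hss u).mul_left (1 + u)).tsum_sub hds,
        ← ((hss (u * q)).mul_left (1 + c * u)).tsum_sub hds, s1.tsum_eq_zero_add]
      have h0 := hu 0
      rw [pow_zero, mul_one] at h0 ⊢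
      rw [mul_left_comm, mul_inv_cancel₀ h0, mul_one, sub_self, zero_add]
      refine tsum_congr fun m => ?_
      have h1 := hu (m + 1)
      have h2 : 1 + u * q * (q : ℂ) ^ m ≠ 0 := by
        rw [pow_succ'] at h1; rwa [mul_assoc]
      have h3 : 1 + u * q * (q : ℂ) ^ m = 1 + u * (q : ℂ) ^ (m + 1) := by rw [pow_succ']; ring
      rw [h3]
      field_simp
      linear_combination u * hdr m
    linear_combination e1
  have hn : ∀ n : ℕ, qPochFin q (-t) n * S t = qPochFin q (-(c * t)) n * S (t * (q : ℂ) ^ n) := by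
    intro n
    induction n with
    | zero => simp [qPochFin_zero]
    | succ n ih =>
      have h := hfe (t * (q : ℂ) ^ n) fun k => by rw [mul_assoc, ← pow_add]; exact hne _
      rw [qPochFin_succ, qPochFin_succ, pow_succ, ← mul_assoc t]
      linear_combination (1 + t * (q : ℂ) ^ n) * ih + qPochFin q (-(c * t)) n * h
  obtain ⟨C, hC0, hC⟩ := exists_norm_inv_one_add_le hq0 hq1 t
  have hlim : Tendsto (fun n : ℕ => S (t * (q : ℂ) ^ n)) atTop (𝓝 (∑' m, d m)) := by
    have hq : ‖(q : ℂ)‖ < 1 := by rwa [norm_q hq0]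
    refine tendsto_tsum_of_dominated_convergence (hdn.mul_right C) (fun m => ?_)
      (Eventually.of_forall fun n m => ?_)
    · have h := ((((tendsto_pow_atTop_nhds_zero_of_norm_lt_one hq).const_mul t).mul_const
        ((q : ℂ) ^ m)).const_add 1).inv₀ (by simp)
      simpa using h.const_mul (d m)
    · rw [norm_mul, mul_assoc, ← pow_add]
      gcongr
      exact hC _
  have h1 := (tendsto_qPochFin hq0 hq1 (-(c * t))).mul hlim
  have h2 := (tendsto_qPochFin hq0 hq1 (-t)).mul_const (S t)
  simp only [hn] at h2
  have h3 := tendsto_nhds_unique h2 h1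
  have h4 : ∑' m, d m = _ := tsum_pfCoeff hq0 hq1 hc
  have h5 := qPoch_ne_zero hq0 hq1 ht
  rw [h4] at h3
  change S t = _
  field_simp
  linear_combination h3

/-! ### Bilateral partial fractions of the theta quotient. -/

theorem exists_norm_inv_one_add_zpow_le (hq0 : 0 < q) (hq1 : q < 1) {t : ℂ} (ht0 : t ≠ 0) :
    ∃ C : ℝ, 0 < C ∧ ∀ n : ℤ, ‖(1 + (q : ℂ) ^ n * t)⁻¹‖ ≤ C := by
  have hq := q_ne_zero hq0
  obtain ⟨C₁, h₁, hC₁⟩ := exists_norm_inv_one_add_le hq0 hq1 t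
  obtain ⟨C₂, h₂, hC₂⟩ := exists_norm_inv_one_add_le hq0 hq1 t⁻¹
  refine ⟨max C₁ (‖t⁻¹‖ * C₂), lt_max_of_lt_left h₁, fun n => ?_⟩
  obtain ⟨k, rfl | rfl⟩ := n.eq_nat_or_neg
  · rw [zpow_natCast, mul_comm]
    exact (hC₁ k).trans (le_max_left _ _)
  · refine le_trans ?_ (le_max_right _ _)
    have e : (1 + (q : ℂ) ^ (-(k : ℤ)) * t)⁻¹ = (q : ℂ) ^ k * t⁻¹ * (1 + t⁻¹ * (q : ℂ) ^ k)⁻¹ := by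
      have h := pow_ne_zero k hq
      have e1 : 1 + (q : ℂ) ^ (-(k : ℤ)) * t = (1 + t⁻¹ * (q : ℂ) ^ k) * (t * ((q : ℂ) ^ k)⁻¹) := by
        rw [zpow_neg, zpow_natCast]
        field_simp
        ring
      rw [e1, mul_inv, mul_inv, inv_inv]
      ring
    rw [e, norm_mul, norm_mul, norm_pow, norm_q hq0]
    gcongr
    · exact mul_le_of_le_one_left (norm_nonneg _) (pow_le_one₀ hq0.le hq1.le)
    · exact hC₂ k

/-- The coefficients of the partial fraction expansion of `(-cqτ; q)_∞ / θ_q(qτ)`. -/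
noncomputable def pfWeight (q : ℝ) (c : ℂ) (s : ℤ) : ℂ :=
  (-1) ^ s * (q : ℂ) ^ tri s * qPoch q (c * (q : ℂ) ^ (1 - s))

/-- Indices s ≥ 1 belong to the poles of 1/(-qτ;q)_∞, indices s ≤ 0 to those of 1/(-1/τ;q)_∞. This
and `pfWeight_neg_natCast` express the two halves through one-sided coefficients. -/
theorem pfWeight_natCast_succ (hq0 : 0 < q) (hq1 : q < 1) (c : ℂ) (m : ℕ) :
    pfWeight q c (m + 1) = -(qPoch q c * pfCoeff q c m) := by
  have hq := q_ne_zero hq0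
  induction m with
  | zero => simp [pfWeight, pfCoeff_zero, tri]
  | succ m ih =>
    have h := qPoch_eq_one_sub_mul hq0 hq1 (c * (q : ℂ) ^ (1 - ((m : ℤ) + 1 + 1)))
    have e1 : c * (q : ℂ) ^ (1 - ((m : ℤ) + 1 + 1)) * q = c * (q : ℂ) ^ (1 - ((m : ℤ) + 1)) := by
      rw [mul_assoc, ← zpow_add_one₀ hq]; ring_nf
    have e2 : (q : ℂ) ^ (1 - ((m : ℤ) + 1 + 1)) = ((q : ℂ) ^ (m + 1))⁻¹ := by
      rw [← zpow_natCast, ← zpow_neg]; push_cast; ring_nf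
    have e3 : pfWeight q c (((m + 1 : ℕ) : ℤ) + 1) =
        pfWeight q c (m + 1) * (c - (q : ℂ) ^ (m + 1)) := by
      have h1 := pow_ne_zero (m + 1) hq
      have e4 : (q : ℂ) ^ tri ((m : ℤ) + 1 + 1) =
          (q : ℂ) ^ tri ((m : ℤ) + 1) * (q : ℂ) ^ (m + 1) := by
        rw [tri_succ, zpow_add₀ hq]
        norm_cast
      rw [pfWeight, pfWeight]
      push_cast
      rw [h, e1, e2, e4, zpow_add_one₀ (by norm_num : (-1 : ℂ) ≠ 0)]
      field_simp
      ring
    rw [e3, ih, pfCoeff_succ]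
    ring

theorem pfCoeff_zero_left (m : ℕ) :
    pfCoeff q 0 m = (-1) ^ m * (q : ℂ) ^ ((m + 1).choose 2) := by
  induction m with
  | zero => simp [pfCoeff_zero]
  | succ m ih =>
    rw [pfCoeff_succ, ih, choose_two_succ (m + 1), pow_add _ _ (m + 1), pow_succ (-1 : ℂ)]
    ring

theorem pfWeight_neg_natCast (c : ℂ) (l : ℕ) :
    pfWeight q c (-(l : ℤ)) = pfCoeff q 0 l * qPoch q (c * (q : ℂ) ^ (l + 1)) := by
  have e1 : tri (-(l : ℤ)) = ((l + 1).choose 2 : ℕ) := by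
    rw [tri_neg, tri_natCast, choose_two_succ]; push_cast; rfl
  have e2 : (1 - -(l : ℤ)) = ((l + 1 : ℕ) : ℤ) := by push_cast; ring
  rw [pfWeight, pfCoeff_zero_left, e1, e2, zpow_natCast, zpow_natCast, zpow_neg, zpow_natCast,
    ← inv_pow]
  norm_num

/-- For s ≥ 1 this is the generating series of `pfCoeff q c` at 1/σ, inside its disc because ‖c‖ <
σ. For s ≤ 0 the coefficients have Gaussian decay. -/
theorem summable_norm_pfWeight (hq0 : 0 < q) (hq1 : q < 1) {c : ℂ} {σ : ℝ} (hσ : 0 < σ)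
    (hc : ‖c‖ < σ) : Summable fun s : ℤ => ‖pfWeight q c s‖ * (σ⁻¹) ^ s := by
  obtain ⟨C, hC0, hC⟩ := exists_norm_qPochFin_le hq0 hq1 (q : ℂ)
  have aux : ∀ {c x : ℂ}, ‖c * x‖ < 1 → Summable fun k : ℕ => ‖x‖ ^ k * ‖pfCoeff q c k‖ := by
    intro c x hx
    refine Summable.of_nonneg_of_le (fun _ => by positivity) (fun k => ?_)
      ((summable_norm_pfCoeff hq0 hq1 hx).mul_left C)
    have h1 := norm_pos_iff.2 (qPochFin_self_ne_zero hq0 hq1 k)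
    rw [norm_mul, norm_div, norm_pow, ← mul_assoc]
    gcongr
    rw [← mul_div_assoc, le_div_iff₀ h1, mul_comm]
    gcongr
    exact hC k
  have hσn : ‖((σ⁻¹ : ℝ) : ℂ)‖ = σ⁻¹ := by
    rw [Complex.norm_real, Real.norm_eq_abs, abs_of_pos (inv_pos.2 hσ)]
  have hσn' : ‖((σ : ℝ) : ℂ)‖ = σ := by
    rw [Complex.norm_real, Real.norm_eq_abs, abs_of_pos hσ]
  have s1 := aux (c := c) (x := ((σ⁻¹ : ℝ) : ℂ)) (by
    rw [norm_mul, hσn, ← div_eq_mul_inv]; exact (div_lt_one hσ).2 hc)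
  have s2 := aux (c := 0) (x := (σ : ℂ)) (by simp)
  rw [hσn] at s1
  rw [hσn'] at s2
  rw [← (Equiv.neg ℤ).summable_iff]
  refine Summable.of_nat_of_neg_add_one ?_ ?_
  · refine Summable.of_nonneg_of_le
      (fun _ => mul_nonneg (norm_nonneg _) (zpow_nonneg (inv_pos.2 hσ).le _)) (fun l => ?_)
      (s2.mul_right ‖qPoch q (-(‖c‖ : ℂ))‖)
    simp only [Function.comp, Equiv.neg_apply]
    rw [pfWeight_neg_natCast, norm_mul, zpow_neg, inv_zpow, inv_inv, zpow_natCast,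
      mul_comm (σ ^ l), mul_right_comm]
    gcongr
    refine norm_qPoch_le hq0 hq1 ?_
    rw [norm_mul, norm_pow, norm_q hq0]
    exact mul_le_of_le_one_right (norm_nonneg _) (pow_le_one₀ hq0.le hq1.le)
  · refine (s1.mul_left (‖qPoch q c‖ * σ⁻¹)).congr fun m => ?_
    simp only [Function.comp, Equiv.neg_apply, neg_neg]
    rw [pfWeight_natCast_succ hq0 hq1, norm_neg, norm_mul, zpow_add_one₀ (inv_pos.2 hσ).ne',
      zpow_natCast]
    ring

theorem summable_norm_pfWeight_mul_inv (hq0 : 0 < q) (hq1 : q < 1) {c : ℂ} (hc : ‖c‖ < 1) {τ : ℂ}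
    (hτ0 : τ ≠ 0) : Summable fun s : ℤ => ‖pfWeight q c s * (1 + (q : ℂ) ^ s * τ)⁻¹‖ := by
  obtain ⟨C, -, hC⟩ := exists_norm_inv_one_add_zpow_le hq0 hq1 hτ0
  refine Summable.of_nonneg_of_le (fun _ => norm_nonneg _) (fun m => ?_)
    ((summable_norm_pfWeight hq0 hq1 one_pos hc).mul_right C)
  rw [norm_mul, inv_one, one_zpow, mul_one]
  gcongr
  exact hC m

/-- The partial fraction expansion of `(-cqτ; q)_∞ / θ_q(qτ)`. -/
theorem tsum_pfWeight (hq0 : 0 < q) (hq1 : q < 1) {c : ℂ} (hc : ‖c‖ < 1) {τ : ℂ}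
    (hτ0 : τ ≠ 0) (hτ : ∀ n : ℤ, τ ≠ -(q : ℂ) ^ n) :
    ∑' s : ℤ, pfWeight q c s * (1 + (q : ℂ) ^ s * τ)⁻¹ =
      -(qPoch q (q : ℂ) ^ 3 * (qPoch q (-(c * q * τ)) / qTheta q (q * τ))) := by
  have hq := q_ne_zero hq0
  have hQ := qPoch_self_ne_zero hq0 hq1
  have hPc := qPoch_ne_zero_of_norm_lt_one hq0 hq1 hc
  have hcond1 : ∀ n : ℕ, -(q * τ) * (q : ℂ) ^ n ≠ 1 := fun n => by
    simpa using zpow_mul_pow_ne_one hq0 hτ 1 n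
  have hτ' : ∀ n : ℤ, τ⁻¹ ≠ -(q : ℂ) ^ n := fun n h => hτ (-n) (by
    rw [zpow_neg, ← inv_neg, ← h, inv_inv])
  have hcond2 : ∀ n : ℕ, -τ⁻¹ * (q : ℂ) ^ n ≠ 1 := fun n => by
    simpa using zpow_mul_pow_ne_one hq0 hτ' 0 n
  have h0 : ‖(0 : ℂ)‖ < 1 := by simp
  -- The quotient factors, up to a constant, as (-cqτ;q)_∞/(-qτ;q)_∞ times 1/(-1/τ;q)_∞. The series
  -- of x and y are the one-sided expansions of the two factors.
  set x : ℕ → ℂ := fun m => pfCoeff q c m / qPochFin q (q : ℂ) m *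
    (1 + q * τ * (q : ℂ) ^ m)⁻¹ with hx
  set y : ℕ → ℂ := fun l => pfCoeff q 0 l / qPochFin q (q : ℂ) l *
    (1 + τ⁻¹ * (q : ℂ) ^ l)⁻¹ with hy
  have hxs : Summable fun m => ‖x m‖ := summable_norm_partialFraction hq0 hq1 hc _
  have hys : Summable fun l => ‖y l‖ := summable_norm_partialFraction hq0 hq1 h0 _
  have hxt := tsum_partialFraction hq0 hq1 hc hcond1
  have hyt := tsum_partialFraction hq0 hq1 h0 hcond2
  set u : ℕ × ℕ → ℂ := fun p => pfCoeff q c p.1 / qPochFin q (q : ℂ) p.1 *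
    (pfCoeff q 0 p.2 / qPochFin q (q : ℂ) p.2) * (1 - (q : ℂ) ^ (p.1 + p.2 + 1))⁻¹ with hu
  set f : ℤ → ℂ := fun s => pfWeight q c s * (1 + (q : ℂ) ^ s * τ)⁻¹ with hf
  obtain ⟨C, hC0, hC⟩ := exists_norm_inv_one_add_zpow_le hq0 hq1 hτ0
  obtain ⟨D, hD0, hD⟩ := exists_norm_inv_one_add_le hq0 hq1 (-q : ℂ)
  have hus : Summable fun p => ‖u p‖ := by
    refine Summable.of_nonneg_of_le (fun _ => norm_nonneg _) (fun p => ?_)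
      (((summable_norm_pfCoeff_div hq0 hq1 hc).mul_of_nonneg (summable_norm_pfCoeff_div hq0 hq1 h0)
        (fun _ => norm_nonneg _) (fun _ => norm_nonneg _)).mul_right D)
    rw [hu]
    simp only [norm_mul]
    gcongr
    have := hD (p.1 + p.2)
    rwa [neg_mul, ← sub_eq_add_neg, ← pow_succ'] at this
  have hu1 : Summable fun p : ℕ × ℕ => u p * (1 + (q : ℂ) ^ ((p.1 : ℤ) + 1) * τ)⁻¹ := by
    refine Summable.of_norm_bounded (hus.mul_right C) fun p => ?_
    rw [norm_mul]
    gcongr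
    exact hC _
  have hu2 : Summable fun p : ℕ × ℕ => u p * (1 + (q : ℂ) ^ (-(p.2 : ℤ)) * τ)⁻¹ := by
    refine Summable.of_norm_bounded (hus.mul_right C) fun p => ?_
    rw [norm_mul]
    gcongr
    exact hC _
  have hpt : ∀ p : ℕ × ℕ, x p.1 * y p.2 = u p * (1 + (q : ℂ) ^ ((p.1 : ℤ) + 1) * τ)⁻¹ -
      u p * (1 + (q : ℂ) ^ (-(p.2 : ℤ)) * τ)⁻¹ := by
    rintro ⟨m, l⟩
    have h1 : 1 + q * τ * (q : ℂ) ^ m ≠ 0 := fun h => hcond1 m (by linear_combination -h)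
    have h2 : 1 + τ⁻¹ * (q : ℂ) ^ l ≠ 0 := fun h => hcond2 l (by linear_combination -h)
    have h3 := one_sub_q_pow_ne_zero hq0 hq1 (m + l)
    have e1 : 1 + (q : ℂ) ^ ((m : ℤ) + 1) * τ = 1 + q * τ * (q : ℂ) ^ m := by
      rw [zpow_add_one₀ hq, zpow_natCast]; ring
    have e2 : (1 + (q : ℂ) ^ (-(l : ℤ)) * τ)⁻¹ = 1 - (1 + τ⁻¹ * (q : ℂ) ^ l)⁻¹ := by
      have h4 := pow_ne_zero l hq
      have e3 : 1 + (q : ℂ) ^ (-(l : ℤ)) * τ = (1 + τ⁻¹ * (q : ℂ) ^ l) * (τ * ((q : ℂ) ^ l)⁻¹) := by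
        rw [zpow_neg, zpow_natCast]
        field_simp
        ring
      rw [e3, eq_sub_iff_add_eq, mul_inv, mul_inv, inv_inv]
      generalize τ⁻¹ * (q : ℂ) ^ l = B at h2 ⊢
      field_simp
      ring
    -- With A = qτq^m and B = q^l/τ the product AB = q^(m+l+1) is free of τ, so 1/((1+A)(1+B))
    -- splits into simple fractions with constant coefficients.
    have e4 : (1 + q * τ * (q : ℂ) ^ m)⁻¹ * (1 + τ⁻¹ * (q : ℂ) ^ l)⁻¹ =
        (1 - (q : ℂ) ^ (m + l + 1))⁻¹ *
          ((1 + q * τ * (q : ℂ) ^ m)⁻¹ - (1 - (1 + τ⁻¹ * (q : ℂ) ^ l)⁻¹)) := by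
      have e5 : (q : ℂ) ^ (m + l + 1) = (q * τ * (q : ℂ) ^ m) * (τ⁻¹ * (q : ℂ) ^ l) := by
        field_simp
        ring
      rw [e5] at h3 ⊢
      generalize q * τ * (q : ℂ) ^ m = A at *
      generalize τ⁻¹ * (q : ℂ) ^ l = B at *
      field_simp
      ring
    simp only [hx, hy, hu]
    rw [e1, e2]
    linear_combination (pfCoeff q c m / qPochFin q (q : ℂ) m *
      (pfCoeff q 0 l / qPochFin q (q : ℂ) l)) * e4
  have htail : ∀ m : ℕ, qPoch q (q : ℂ) / qPoch q ((q : ℂ) ^ (m + 1)) = qPochFin q (q : ℂ) m := by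
    intro m
    have h := qPoch_eq_qPochFin_mul hq0 hq1 (q : ℂ) m
    rw [← pow_succ'] at h
    rw [h, mul_div_cancel_right₀ _ (right_ne_zero_of_mul (h ▸ hQ))]
  have hcond3 : ∀ m n : ℕ, -(-(q : ℂ) ^ (m + 1)) * (q : ℂ) ^ n ≠ 1 := fun m n h =>
    one_sub_q_pow_ne_zero hq0 hq1 (m + n) (by
      rw [neg_neg, ← pow_add] at h
      rw [show m + n + 1 = m + 1 + n by ring, h, sub_self])
  -- The coefficient collected at each pole is again a one-sided expansion, now at t = -q^(m+1);
  -- `hin2` uses t = -q^(l+1).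
  have hin1 : ∀ m : ℕ, ∑' l, u (m, l) = pfCoeff q c m := by
    intro m
    have h := tsum_partialFraction hq0 hq1 h0 (hcond3 m)
    have h1 := qPochFin_self_ne_zero hq0 hq1 m
    rw [qPoch_zero, div_one, zero_mul, neg_zero, qPoch_zero, neg_neg, mul_one_div, htail] at h
    calc ∑' l, u (m, l) = ∑' l, pfCoeff q c m / qPochFin q (q : ℂ) m *
          (pfCoeff q 0 l / qPochFin q (q : ℂ) l * (1 + -(q : ℂ) ^ (m + 1) * (q : ℂ) ^ l)⁻¹) := by
          refine tsum_congr fun l => ?_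
          simp only [hu]
          rw [neg_mul, ← sub_eq_add_neg, ← pow_add, mul_assoc, add_right_comm]
      _ = _ := by rw [tsum_mul_left, h, div_mul_cancel₀ _ h1]
  have hin2 : ∀ l : ℕ, ∑' m, u (m, l) =
      (qPoch q c)⁻¹ * (pfCoeff q 0 l * qPoch q (c * (q : ℂ) ^ (l + 1))) := by
    intro l
    have h := tsum_partialFraction hq0 hq1 hc (hcond3 l)
    have h1 := qPochFin_self_ne_zero hq0 hq1 l
    rw [neg_neg, mul_neg, neg_neg, div_mul_div_comm, mul_comm (qPoch q c), mul_div_mul_comm,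
      htail] at h
    calc ∑' m, u (m, l) = ∑' m, pfCoeff q 0 l / qPochFin q (q : ℂ) l *
          (pfCoeff q c m / qPochFin q (q : ℂ) m * (1 + -(q : ℂ) ^ (l + 1) * (q : ℂ) ^ m)⁻¹) := by
          refine tsum_congr fun m => ?_
          simp only [hu]
          rw [neg_mul, ← sub_eq_add_neg, ← pow_add, show m + l + 1 = l + 1 + m by ring]
          ring
      _ = _ := by rw [tsum_mul_left, h]; field_simp
  have hsum : (∑' m, x m) * ∑' l, y l = -(qPoch q c)⁻¹ * ∑' s, f s := by
    have hfs : Summable f := (summable_norm_pfWeight_mul_inv hq0 hq1 hc hτ0).of_norm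
    have hfs' := ((Equiv.neg ℤ).summable_iff (f := f)).2 hfs
    have i1 : Function.Injective fun n : ℕ => (n : ℤ) := Nat.cast_injective
    have i2 : Function.Injective fun n : ℕ => (n : ℤ) + 1 := fun a b h => by simpa using h
    have e1 : ∑' s, f s = ∑' l : ℕ, f (-(l : ℤ)) + ∑' m : ℕ, f ((m : ℤ) + 1) := by
      rw [← (Equiv.neg ℤ).tsum_eq f]
      refine (HasSum.of_nat_of_neg_add_one (f := fun s => f (Equiv.neg ℤ s)) ?_ ?_).tsum_eq
      · exact (hfs'.comp_injective i1).hasSum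
      · simp only [Equiv.neg_apply, neg_neg]
        exact (hfs.comp_injective i2).hasSum
    rw [tsum_mul_tsum_of_summable_norm hxs hys, tsum_congr hpt, hu1.tsum_sub hu2, hu1.tsum_prod,
      hu2.tsum_prod, e1, mul_add, ← tsum_mul_left, ← tsum_mul_left, sub_eq_neg_add]
    congr 1
    · rw [Summable.tsum_comm (f := fun l m => u (m, l) * (1 + (q : ℂ) ^ (-(l : ℤ)) * τ)⁻¹)
        hu2.prod_symm, ← tsum_neg]
      refine tsum_congr fun l => ?_
      rw [tsum_mul_right, hin2]
      simp only [hf]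
      rw [pfWeight_neg_natCast]
      ring
    · refine tsum_congr fun m => ?_
      dsimp only
      rw [tsum_mul_right, hin1]
      simp only [hf]
      rw [pfWeight_natCast_succ hq0 hq1]
      field_simp
  have hE : ∑' s, f s = -qPoch q c * ((∑' m, x m) * ∑' l, y l) := by
    rw [hsum]; field_simp
  have e3 : -((q : ℂ) / (q * τ)) = -τ⁻¹ := by field_simp
  have e4 : c * q * τ = c * (q * τ) := by ring
  rw [hE, hxt, hyt, qPoch_zero, zero_mul, neg_zero, qPoch_zero, qTheta, e3, e4]
  have h5 := qPoch_ne_zero hq0 hq1 hcond1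
  have h6 := qPoch_ne_zero hq0 hq1 hcond2
  field_simp

/-! ### The analytic continuation of `₂φ₁` -/

theorem differentiable_tsum_of_norm_le {F : ℕ → ℂ → ℂ} (hF : ∀ k, Differentiable ℂ (F k))
    {u : ℝ → ℕ → ℝ} (hu : ∀ R, 0 < R → Summable (u R))
    (hle : ∀ R, 0 < R → ∀ k w, ‖w‖ ≤ R → ‖F k w‖ ≤ u R k) :
    Differentiable ℂ fun w => ∑' k, F k w := by
  intro x
  have hR : 0 < ‖x‖ + 1 := by positivity
  refine (Complex.differentiableOn_tsum_of_summable_norm (hu _ hR)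
    (fun k => (hF k).differentiableOn) (Metric.isOpen_ball (x := (0 : ℂ)) (ε := ‖x‖ + 1))
    (fun k w hw => hle _ hR k w (by simpa using (mem_ball_zero_iff.1 hw).le))).differentiableAt
    (Metric.isOpen_ball.mem_nhds (by simp))

/-- Euler's series converges uniformly on bounded sets. -/
theorem differentiable_qPoch (hq0 : 0 < q) (hq1 : q < 1) : Differentiable ℂ (qPoch q) := by
  have h : Differentiable ℂ fun w : ℂ =>
      ∑' k : ℕ, (q : ℂ) ^ (k.choose 2) * (-w) ^ k / qPochFin q (q : ℂ) k := by
    refine differentiable_tsum_of_norm_le (fun k => by fun_prop)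
      (u := fun R k => ‖(q : ℂ) ^ (k.choose 2) * (R : ℂ) ^ k / qPochFin q (q : ℂ) k‖)
      (fun R _ => summable_norm_euler hq0 hq1 R) (fun R hR k w hw => ?_)
    rw [norm_div, norm_div, norm_mul, norm_mul, norm_pow (-w), norm_pow (R : ℂ), norm_neg,
      Complex.norm_real, Real.norm_eq_abs, abs_of_pos hR]
    gcongr
  convert h using 2 with w
  rw [tsum_euler hq0 hq1, neg_neg]

/-- The coefficients of the entire function `(x; q)_∞ ₂φ₁(a, b; 0; q, x)`. -/
noncomputable def jacksonCoeff (q : ℝ) (a b : ℂ) (k : ℕ) : ℂ :=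
  (q : ℂ) ^ (k.choose 2) * (-a) ^ k / qPochFin q (q : ℂ) k * qPochFin q b k

theorem summable_norm_jacksonCoeff (hq0 : 0 < q) (hq1 : q < 1) (a b x : ℂ) :
    Summable fun k => ‖jacksonCoeff q a b k * x ^ k‖ := by
  obtain ⟨C, hC0, hC⟩ := exists_norm_qPochFin_le hq0 hq1 b
  refine Summable.of_nonneg_of_le (fun _ => norm_nonneg _) (fun k => ?_)
    ((summable_norm_euler hq0 hq1 (-a * x)).mul_right C)
  have e : jacksonCoeff q a b k * x ^ k =
      (q : ℂ) ^ (k.choose 2) * (-a * x) ^ k / qPochFin q (q : ℂ) k * qPochFin q b k := by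
    rw [jacksonCoeff, mul_pow]; ring
  rw [e, norm_mul]
  gcongr
  exact hC k

theorem norm_qPoch_mul_pow_le (hq0 : 0 < q) (hq1 : q < 1) {c : ℂ} {r : ℝ} (hc : ‖c‖ ≤ r) (k : ℕ) :
    ‖qPoch q (c * (q : ℂ) ^ k)‖ ≤ ‖qPoch q (-(r : ℂ))‖ := by
  refine norm_qPoch_le hq0 hq1 ?_
  rw [norm_mul, norm_pow, norm_q hq0]
  exact (mul_le_of_le_one_right (norm_nonneg _) (pow_le_one₀ hq0.le hq1.le)).trans hc

/-- Jackson's series for the analytic continuation of `₂φ₁(a, b; 0; q, x)`. -/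
noncomputable def jackson (q : ℝ) (a b x : ℂ) : ℂ :=
  (∑' k : ℕ, jacksonCoeff q a b k * x ^ k * qPoch q (b * x * (q : ℂ) ^ k)) / qPoch q x

theorem differentiable_jackson_num (hq0 : 0 < q) (hq1 : q < 1) (a b : ℂ) :
    Differentiable ℂ fun x : ℂ =>
      ∑' k : ℕ, jacksonCoeff q a b k * x ^ k * qPoch q (b * x * (q : ℂ) ^ k) := by
  refine differentiable_tsum_of_norm_le (fun k => ?_)
    (u := fun R k => ‖jacksonCoeff q a b k * (R : ℂ) ^ k‖ *
      ‖qPoch q (-((‖b‖ * R : ℝ) : ℂ))‖)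
    (fun R _ => (summable_norm_jacksonCoeff hq0 hq1 a b R).mul_right _) (fun R hR k w hw => ?_)
  · have := differentiable_qPoch hq0 hq1
    fun_prop
  · rw [norm_mul, norm_mul, norm_mul, norm_pow, norm_pow, Complex.norm_real, Real.norm_eq_abs,
      abs_of_pos hR]
    gcongr
    refine norm_qPoch_mul_pow_le hq0 hq1 ?_ k
    rw [norm_mul]
    gcongr

theorem hasSum_antidiagonal {F : ℕ × ℕ → ℂ} (hF : Summable F) :
    HasSum (fun n => ∑ p ∈ Finset.HasAntidiagonal.antidiagonal n, F p) (∑' p, F p) := by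
  have h := (Finset.HasAntidiagonal.sigmaAntidiagonalEquivProd (A := ℕ)).hasSum_iff.2 hF.hasSum
  refine h.sigma fun n => ?_
  have h2 := hasSum_fintype fun c : Finset.HasAntidiagonal.antidiagonal n => F c
  rwa [Finset.sum_coe_sort (Finset.HasAntidiagonal.antidiagonal n) F] at h2

theorem qPhi_two_one (a b x : ℂ) : qPhi q [a, b] [0] x =
    ∑' n : ℕ, qPochFin q a n * qPochFin q b n / qPochFin q (q : ℂ) n * x ^ n := by
  refine tsum_congr fun n => ?_
  simp [qPochFin_zero_left]

theorem qPhi_eq_jackson (hq0 : 0 < q) (hq1 : q < 1) (a b : ℂ) {x : ℂ} (hx : ‖x‖ < 1) :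
    qPhi q [a, b] [0] x = jackson q a b x := by
  obtain ⟨C, hC0, hC⟩ := exists_norm_qPochFin_le hq0 hq1 b
  -- Expand (a;q)_n/(q;q)_n by Gauss over i + j = n. For fixed i, (b;q)_(i+j) = (b;q)_i (bq^i;q)_j,
  -- and the sum over j is q-binomial.
  set F : ℕ × ℕ → ℂ := fun p => (q : ℂ) ^ (p.1.choose 2) * (-a * x) ^ p.1 /
    qPochFin q (q : ℂ) p.1 * (x ^ p.2 / qPochFin q (q : ℂ) p.2) * qPochFin q b (p.1 + p.2) with hF
  have hFs : Summable F := by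
    refine Summable.of_norm_bounded
      (((summable_norm_euler hq0 hq1 (-a * x)).mul_of_nonneg (summable_norm_pow_div hq0 hq1 hx)
        (fun _ => norm_nonneg _) (fun _ => norm_nonneg _)).mul_right C) fun p => ?_
    rw [hF]
    simp only [norm_mul _ (qPochFin q b _), norm_mul _ (x ^ p.2 / _)]
    gcongr
    exact hC _
  have h1 : ∀ n : ℕ, qPochFin q a n * qPochFin q b n / qPochFin q (q : ℂ) n * x ^ n =
      ∑ p ∈ Finset.HasAntidiagonal.antidiagonal n, F p := by
    intro n
    have h := qDiff_expansion hq0 hq1 a (Y := fun k _ => qPochFin q a k) (qPochFin_qDiff a) n 0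
    rw [mul_div_right_comm, h, Finset.sum_mul, Finset.sum_mul]
    refine Finset.sum_congr rfl fun p hp => ?_
    simp only [hF]
    rw [Finset.HasAntidiagonal.mem_antidiagonal.1 hp,
      ← Finset.HasAntidiagonal.mem_antidiagonal.1 hp, pow_add, mul_pow, qPochFin_zero]
    ring
  have h2 : ∀ i : ℕ, ∑' j : ℕ, F (i, j) =
      jacksonCoeff q a b i * x ^ i * qPoch q (b * x * (q : ℂ) ^ i) / qPoch q x := by
    intro i
    have h := tsum_qBinomial hq0 hq1 (b * (q : ℂ) ^ i) hx
    rw [mul_right_comm b, mul_div_assoc, ← h, ← tsum_mul_left]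
    refine tsum_congr fun j => ?_
    simp only [hF]
    rw [qPochFin_add, jacksonCoeff, mul_pow]
    ring
  rw [qPhi_two_one, jackson, tsum_congr h1, (hasSum_antidiagonal hFs).tsum_eq, hFs.tsum_prod,
    tsum_congr h2, tsum_div_const]

theorem qPoch_ne_zero_of_mem (hq0 : 0 < q) (hq1 : q < 1) {x : ℂ} (hx : x ∈ borelDomain q) :
    qPoch q x ≠ 0 :=
  qPoch_ne_zero hq0 hq1 fun n h => hx n (eq_inv_of_mul_eq_one_left h)

theorem isPhi21Continuation_jackson (hq0 : 0 < q) (hq1 : q < 1) (a b : ℂ) :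
    IsPhi21Continuation q a b (jackson q a b) := by
  refine ⟨fun x hx => ?_, fun x hx => (qPhi_eq_jackson hq0 hq1 a b hx).symm⟩
  exact ((differentiable_jackson_num hq0 hq1 a b).analyticAt x).div
    ((differentiable_qPoch hq0 hq1).analyticAt x) (qPoch_ne_zero_of_mem hq0 hq1 hx)

theorem isPhi21Continuation_phi21Cont (hq0 : 0 < q) (hq1 : q < 1) (a b : ℂ) :
    IsPhi21Continuation q a b (phi21Cont q a b) :=
  Classical.epsilon_spec ⟨_, isPhi21Continuation_jackson hq0 hq1 a b⟩

theorem phi21Cont_eq_jackson (hq0 : 0 < q) (hq1 : q < 1) (a b : ℂ) {x : ℂ}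
    (hx : x ∈ borelDomain q) : phi21Cont q a b x = jackson q a b x :=
  (isPhi21Continuation_phi21Cont hq0 hq1 a b).eqOn hq0 (isPhi21Continuation_jackson hq0 hq1 a b) hx

/-- The defining predicates coincide, so the chosen functions agree everywhere, even at the excluded
points. -/
theorem phi21Cont_comm (a b : ℂ) : phi21Cont q a b = phi21Cont q b a := by
  have h : IsPhi21Continuation q a b = IsPhi21Continuation q b a := by
    funext F
    simp only [IsPhi21Continuation, qPhi_two_one, mul_comm (qPochFin q a _)]
  rw [phi21Cont, phi21Cont, h]

/-- The `k`-th numerator in the expansion of `₂φ₁(a, b; 0; q, -t)` in powers of `a`. -/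
noncomputable def expTerm (q : ℝ) (b t : ℂ) (k : ℕ) : ℂ :=
  qPochFin q b k * ((q : ℂ) ^ (k.choose 2) * t ^ k) *
    (qPoch q (-(b * t * (q : ℂ) ^ k)) / qPoch q (-t))

theorem jackson_neg (a b t : ℂ) :
    jackson q a b (-t) = ∑' k : ℕ, a ^ k / qPochFin q (q : ℂ) k * expTerm q b t k := by
  rw [jackson, ← tsum_div_const]
  refine tsum_congr fun k => ?_
  rw [jacksonCoeff, expTerm, neg_pow a, neg_pow t, mul_neg, neg_mul]
  have : ((-1 : ℂ) ^ k) * (-1) ^ k = 1 := by rw [← mul_pow]; simp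
  linear_combination ((q : ℂ) ^ k.choose 2 * a ^ k / qPochFin q (q : ℂ) k * qPochFin q b k * t ^ k *
    qPoch q (-(b * t * (q : ℂ) ^ k)) / qPoch q (-t)) * this

/-- Over the common denominator (-t;q)_∞ this is (1+t) - (1+btq^k) = t(1-bq^k). Thus the terms are
iterated q-differences for t ↦ qt, with β = 1. -/
theorem expTerm_succ (hq0 : 0 < q) (hq1 : q < 1) (b : ℂ) {t : ℂ}
    (ht : ∀ n : ℕ, -t * (q : ℂ) ^ n ≠ 1) (k : ℕ) :
    expTerm q b t (k + 1) = expTerm q b (t * q) k - (q : ℂ) ^ k * expTerm q b t k := by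
  have h1 := qPoch_eq_one_sub_mul hq0 hq1 (-t)
  have h2 := qPoch_eq_one_sub_mul hq0 hq1 (-(b * t * (q : ℂ) ^ k))
  have h3 := qPoch_ne_zero hq0 hq1 ht
  rw [h1] at h3
  have h4 := left_ne_zero_of_mul h3
  have h5 := right_ne_zero_of_mul h3
  have e1 : -(b * t * (q : ℂ) ^ (k + 1)) = -(b * t * (q : ℂ) ^ k) * q := by rw [pow_succ]; ring
  have e2 : -(b * (t * q) * (q : ℂ) ^ k) = -(b * t * (q : ℂ) ^ k) * q := by ring
  have e3 : -(t * (q : ℂ)) = -t * q := by ring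
  rw [expTerm, expTerm, expTerm, e1, e2, e3, h1, h2, choose_two_succ, qPochFin_succ]
  field_simp
  ring

/-! ### Double series over `ℤ × ℕ` -/

/-- The shear `(n, k) ↦ (n - k, k)`. -/
def shear : ℤ × ℕ ≃ ℤ × ℕ where
  toFun p := (p.1 - p.2, p.2)
  invFun p := (p.1 + p.2, p.2)
  left_inv p := by simp
  right_inv p := by simp

theorem summable_shear_iff {f : ℤ → ℕ → ℂ} :
    (Summable fun p : ℤ × ℕ => f (p.1 - p.2) p.2) ↔ Summable fun p : ℤ × ℕ => f p.1 p.2 :=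
  shear.summable_iff (f := fun p : ℤ × ℕ => f p.1 p.2)

theorem tsum_shear {f : ℤ → ℕ → ℂ} (hf : Summable fun p : ℤ × ℕ => f p.1 p.2) :
    ∑' n : ℤ, ∑' k : ℕ, f n k = ∑' n : ℤ, ∑' k : ℕ, f (n - k) k := by
  rw [← hf.tsum_prod, ← (summable_shear_iff.2 hf).tsum_prod]
  exact (shear.tsum_eq (fun p : ℤ × ℕ => f p.1 p.2)).symm

/-! ### The resummation as a double series -/

/-- The weight `1 / θ_q(q^n λ / z)` of the discrete `q`-Laplace transform. -/
noncomputable def weight (q : ℝ) (lam z : ℂ) (n : ℤ) : ℂ :=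
  (qTheta q ((q : ℂ) ^ n * lam / z))⁻¹

/-- The quotient `(-bt; q)_∞ / (-t; q)_∞` at `t = q^n λ`. -/
noncomputable def ratio (q : ℝ) (lam b : ℂ) (n : ℤ) : ℂ :=
  qPoch q (-(b * (q : ℂ) ^ n * lam)) / qPoch q (-((q : ℂ) ^ n * lam))

theorem neg_mem_borelDomain (hq0 : 0 < q) {lam : ℂ} (hlam : ∀ n : ℤ, lam ≠ -(q : ℂ) ^ n) (n : ℤ) :
    -((q : ℂ) ^ n * lam) ∈ borelDomain q := fun m h =>
  zpow_mul_pow_ne_one hq0 hlam n m (by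
    rw [h, inv_mul_cancel₀ (pow_ne_zero m (q_ne_zero hq0))])

theorem weight_ne_zero (hq0 : 0 < q) (hq1 : q < 1) {lam z : ℂ} (hz0 : z ≠ 0)
    (hz : ∀ n : ℤ, z ≠ -((q : ℂ) ^ n * lam)) (n : ℤ) : weight q lam z n ≠ 0 := by
  refine inv_ne_zero (qTheta_ne_zero hq0 hq1 fun m h => hz (n - m) ?_)
  have hq := q_ne_zero hq0
  have h1 := zpow_ne_zero m hq
  rw [div_eq_iff hz0] at h
  rw [zpow_sub₀ hq, div_mul_eq_mul_div, h]
  field_simp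

theorem qUTerm_eq (hq0 : 0 < q) (hq1 : q < 1) {lam : ℂ} (hlam : ∀ n : ℤ, lam ≠ -(q : ℂ) ^ n)
    (a b z : ℂ) (n : ℤ) : qUTerm q lam a b z n = ∑' k : ℕ, weight q lam z n *
      (a ^ k / qPochFin q (q : ℂ) k * expTerm q b ((q : ℂ) ^ n * lam) k) := by
  rw [qUTerm, phi21Cont_eq_jackson hq0 hq1 a b (neg_mem_borelDomain hq0 hlam n), jackson_neg,
    div_eq_mul_inv, mul_comm, tsum_mul_left, weight]

/-- The `k`-th iterated `q`-difference of `t ↦ (-bt; q)_∞ / (-t; q)_∞` at `t = q^n λ`, taken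
towards infinity. -/
noncomputable def outTerm (q : ℝ) (lam b : ℂ) (n : ℤ) (k : ℕ) : ℂ :=
  qPochFin q b k * (qPoch q (-(b * (q : ℂ) ^ n * lam)) / qPoch q (-((q : ℂ) ^ (n - k) * lam)))

/-- With v = q^(n-1-k)λ, the identity reduces to (1 + bq^k v) - bq^k(1+v) = 1 - bq^k. -/
theorem outTerm_succ (hq0 : 0 < q) (hq1 : q < 1) {lam : ℂ} (hlam : ∀ n : ℤ, lam ≠ -(q : ℂ) ^ n)
    (b : ℂ) (n : ℤ) (k : ℕ) :
    outTerm q lam b n (k + 1) =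
      outTerm q lam b (n - 1) k - b * (q : ℂ) ^ k * outTerm q lam b n k := by
  have hq := q_ne_zero hq0
  have h1 := qPoch_eq_one_sub_mul hq0 hq1 (-((q : ℂ) ^ (n - 1 - k) * lam))
  have h2 := qPoch_eq_one_sub_mul hq0 hq1 (-(b * (q : ℂ) ^ (n - 1) * lam))
  have h3 := qPoch_zpow_ne_zero hq0 hq1 hlam (n - 1 - k)
  have e1 : -((q : ℂ) ^ (n - 1 - k) * lam) * q = -((q : ℂ) ^ (n - k) * lam) := by
    rw [show n - (k : ℤ) = n - 1 - k + 1 by ring, zpow_add_one₀ hq]; ring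
  have e2 : -(b * (q : ℂ) ^ (n - 1) * lam) * q = -(b * (q : ℂ) ^ n * lam) := by
    rw [zpow_sub_one₀ hq]; field_simp
  have e3 : n - ((k + 1 : ℕ) : ℤ) = n - 1 - k := by push_cast; ring
  have e4 : (q : ℂ) ^ (n - 1) = (q : ℂ) ^ k * (q : ℂ) ^ (n - 1 - k) := by
    rw [← zpow_natCast, ← zpow_add₀ hq]; congr 1; ring
  rw [e1] at h1
  rw [e2] at h2
  rw [h1] at h3
  have h4 := left_ne_zero_of_mul h3
  have h5 := right_ne_zero_of_mul h3
  rw [outTerm, outTerm, outTerm, e3, h1, h2, qPochFin_succ, e4]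
  rw [sub_neg_eq_add] at h4
  simp only [sub_neg_eq_add]
  generalize qPoch q (-((q : ℂ) ^ (n - k) * lam)) = P at *
  generalize (q : ℂ) ^ (n - 1 - k) = w at *
  have h6 : 1 + lam * w ≠ 0 := by rwa [mul_comm lam]
  rw [mul_comm w]
  field_simp
  ring

theorem weight_mul_expTerm (hq0 : 0 < q) (hq1 : q < 1) {lam z : ℂ} (hlam0 : lam ≠ 0) (hz0 : z ≠ 0)
    (a b : ℂ) (n : ℤ) (k : ℕ) : weight q lam z (n - k) *
      (a ^ k / qPochFin q (q : ℂ) k * expTerm q b ((q : ℂ) ^ (n - k) * lam) k) =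
        weight q lam z n * ((a * z) ^ k / qPochFin q (q : ℂ) k * outTerm q lam b n k) := by
  have hq := q_ne_zero hq0
  have h := weight_mul_pow hq0 hq1 hlam0 hz0 (n - k) k
  rw [sub_add_cancel] at h
  have e : b * ((q : ℂ) ^ (n - k) * lam) * (q : ℂ) ^ k = b * (q : ℂ) ^ n * lam := by
    rw [zpow_sub₀ hq, zpow_natCast]
    field_simp
  rw [expTerm, outTerm, e, weight, weight, mul_pow]
  linear_combination (a ^ k / qPochFin q (q : ℂ) k * qPochFin q b k *
    (qPoch q (-(b * (q : ℂ) ^ n * lam)) / qPoch q (-((q : ℂ) ^ (n - k) * lam)))) * h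

/-- No size condition on x, b or z is needed, because the reciprocal product can be bounded by
R^(n-k) with R as large as desired. This is why the resummation converges for all a and b. -/
theorem summable_outTerm (hq0 : 0 < q) (hq1 : q < 1) {lam z : ℂ} (hlam0 : lam ≠ 0) (hz0 : z ≠ 0)
    (hlam : ∀ n : ℤ, lam ≠ -(q : ℂ) ^ n) (x b : ℂ) : Summable fun p : ℤ × ℕ =>
      weight q lam z p.1 * (x ^ p.2 / qPochFin q (q : ℂ) p.2 * outTerm q lam b p.1 p.2) := by
  obtain ⟨C₁, hC₁, h₁⟩ := exists_norm_qPochFin_le hq0 hq1 b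
  obtain ⟨C₂, hC₂, h₂⟩ := exists_norm_inv_qPochFin_self_le hq0 hq1
  -- R exceeds ‖x‖, for the sum over k, and (‖b‖+1)‖z‖, for the sum over n.
  set R : ℝ := 1 + ‖x‖ + (‖b‖ + 1) * ‖z‖ with hR
  have hz := norm_pos_iff.2 hz0
  have hbz : 0 < (‖b‖ + 1) * ‖z‖ := by positivity
  have hR1 : 1 ≤ R := by linarith [norm_nonneg x]
  have hR0 : 0 < R := by linarith
  obtain ⟨C₃, hC₃, h₃⟩ := exists_norm_inv_qPoch_le hq0 hq1 hlam0 hlam hR1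
  have s1 := summable_weight_mul_qPoch hq0 hq1 hlam0 hz0 (b := b) (s := ‖b‖ + 1) (R := R)
    (by positivity) (by linarith) (by linarith [norm_nonneg x])
  have s2 : Summable fun k : ℕ => (‖x‖ / R) ^ k :=
    summable_geometric_of_lt_one (by positivity) ((div_lt_one hR0).2 (by linarith))
  refine Summable.of_norm_bounded ((s1.mul_of_nonneg s2
    (fun n => by simp only [Pi.zero_apply]; positivity)
    (fun n => by simp only [Pi.zero_apply]; positivity)).mul_left (C₁ * C₂ * C₃)) ?_
  rintro ⟨n, k⟩
  have hRn := zpow_pos hR0 n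
  calc _ = ‖weight q lam z n‖ * (‖x‖ ^ k * ‖(qPochFin q (q : ℂ) k)⁻¹‖ * (‖qPochFin q b k‖ *
        (‖qPoch q (-(b * (q : ℂ) ^ n * lam))‖ *
          ‖(qPoch q (-((q : ℂ) ^ (n - k) * lam)))⁻¹‖))) := by
        rw [outTerm]; simp only [norm_mul, div_eq_mul_inv, norm_pow]
    _ ≤ ‖weight q lam z n‖ * (‖x‖ ^ k * C₂ * (C₁ * (‖qPoch q (-(b * (q : ℂ) ^ n * lam))‖ *
          (C₃ * R ^ (n - k))))) := by
        gcongr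
        exacts [h₂ k, h₁ k, h₃ _]
    _ = _ := by
        rw [zpow_sub₀ hR0.ne', zpow_natCast, div_pow, weight]
        ring

theorem summable_expTerm (hq0 : 0 < q) (hq1 : q < 1) {lam z : ℂ} (hlam0 : lam ≠ 0) (hz0 : z ≠ 0)
    (hlam : ∀ n : ℤ, lam ≠ -(q : ℂ) ^ n) (a b : ℂ) : Summable fun p : ℤ × ℕ =>
      weight q lam z p.1 * (a ^ p.2 / qPochFin q (q : ℂ) p.2 *
        expTerm q b ((q : ℂ) ^ p.1 * lam) p.2) := by
  rw [← summable_shear_iff (f := fun n k => weight q lam z n *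
    (a ^ k / qPochFin q (q : ℂ) k * expTerm q b ((q : ℂ) ^ n * lam) k))]
  simp only [weight_mul_expTerm hq0 hq1 hlam0 hz0]
  exact summable_outTerm hq0 hq1 hlam0 hz0 hlam (a * z) b

theorem summable_qUTerm (hq0 : 0 < q) (hq1 : q < 1) {lam z : ℂ} (hlam0 : lam ≠ 0) (hz0 : z ≠ 0)
    (hlam : ∀ n : ℤ, lam ≠ -(q : ℂ) ^ n) (a b : ℂ) : Summable (qUTerm q lam a b z) :=
  (summable_expTerm hq0 hq1 hlam0 hz0 hlam a b).prod.congr fun n =>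
    (qUTerm_eq hq0 hq1 hlam a b z n).symm

theorem qU_eq_tsum_outTerm (hq0 : 0 < q) (hq1 : q < 1) {lam z : ℂ} (hlam0 : lam ≠ 0) (hz0 : z ≠ 0)
    (hlam : ∀ n : ℤ, lam ≠ -(q : ℂ) ^ n) (a b : ℂ) :
    qU q lam a b z = ∑' n : ℤ, weight q lam z n *
      ∑' k : ℕ, (a * z) ^ k / qPochFin q (q : ℂ) k * outTerm q lam b n k := by
  rw [qU, tsum_congr (qUTerm_eq hq0 hq1 hlam a b z),
    tsum_shear (f := fun n k => weight q lam z n *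
      (a ^ k / qPochFin q (q : ℂ) k * expTerm q b ((q : ℂ) ^ n * lam) k))
      (summable_expTerm hq0 hq1 hlam0 hz0 hlam a b)]
  refine tsum_congr fun n => ?_
  rw [← tsum_mul_left]
  exact tsum_congr fun k => weight_mul_expTerm hq0 hq1 hlam0 hz0 a b n k

theorem norm_ratio_le (hq0 : 0 < q) (hq1 : q < 1) {lam : ℂ} (hlam0 : lam ≠ 0)
    (hlam : ∀ n : ℤ, lam ≠ -(q : ℂ) ^ n) (b : ℂ) {s₁ s₂ : ℝ} (hs₁ : 0 < s₁) (hs₁' : s₁ ≤ 1)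
    (hs₂ : 0 < s₂) (hb : ‖b‖ ≤ s₂) :
    ∃ C : ℝ, 0 ≤ C ∧ ∀ m : ℤ, ‖ratio q lam b m‖ ≤ C * ((s₁⁻¹) ^ m + (s₂⁻¹) ^ m) :=
  exists_norm_qPoch_div_le hq0 hq1 hlam0 hlam b hs₁ hs₁' hs₂ hb

/-! ### The form that is symmetric in `a` and `b` -/

theorem summable_ratio_sub (hq0 : 0 < q) (hq1 : q < 1) {lam z : ℂ} (hlam0 : lam ≠ 0) (hz0 : z ≠ 0)
    (hlam : ∀ n : ℤ, lam ≠ -(q : ℂ) ^ n) {x b : ℂ} (hx : ‖x‖ * ‖b‖ < 1) :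
    Summable fun p : ℤ × ℕ => weight q lam z p.1 *
      (x ^ p.2 / qPochFin q (q : ℂ) p.2 * ratio q lam b (p.1 - p.2)) := by
  obtain ⟨C₂, hC₂, h₂⟩ := exists_norm_inv_qPochFin_self_le hq0 hq1
  have hx1 : 0 < 1 + ‖x‖ := by positivity
  set s₁ : ℝ := (1 + ‖x‖)⁻¹ with hs₁
  -- The bound on r_{n-k} contributes s^k, so both rates need ‖x‖s < 1. This s₂ lies slightly above
  -- ‖b‖, is positive even for b = 0, and still satisfies ‖x‖s₂ < 1.
  set s₂ : ℝ := ‖b‖ + (1 - ‖x‖ * ‖b‖) * (1 + ‖x‖)⁻¹ with hs₂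
  have hp₁ : 0 < s₁ := by positivity
  have hd : 0 < (1 - ‖x‖ * ‖b‖) * (1 + ‖x‖)⁻¹ := mul_pos (by linarith) hp₁
  have hp₂ : 0 < s₂ := by positivity
  have hxs : ‖x‖ * s₁ < 1 := by rw [hs₁, ← div_eq_mul_inv, div_lt_one hx1]; linarith
  have hx₂ : ‖x‖ * s₂ < 1 := by
    have : ‖x‖ * s₂ = ‖x‖ * ‖b‖ + (1 - ‖x‖ * ‖b‖) * (‖x‖ * s₁) := by rw [hs₂, hs₁]; ring
    nlinarith
  obtain ⟨C, hC, h⟩ := norm_ratio_le hq0 hq1 hlam0 hlam b hp₁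
    (inv_le_one_of_one_le₀ (by linarith [norm_nonneg x])) hp₂ (by linarith : ‖b‖ ≤ s₂)
  have key : ∀ s : ℝ, 0 < s → ‖x‖ * s < 1 → Summable fun p : ℤ × ℕ =>
      ‖weight q lam z p.1‖ * (s⁻¹) ^ p.1 * (‖x‖ * s) ^ p.2 := fun s hs hxs =>
    (summable_weight hq0 hq1 hlam0 hz0 s⁻¹).mul_of_nonneg
      (summable_geometric_of_lt_one (by positivity) hxs)
      (fun n => mul_nonneg (norm_nonneg _) (zpow_nonneg (inv_pos.2 hs).le _))
      (fun n => by simp only [Pi.zero_apply]; positivity)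
  clear_value s₁ s₂
  refine Summable.of_norm_bounded
    (((key s₁ hp₁ hxs).add (key s₂ hp₂ hx₂)).mul_left (C₂ * C)) ?_
  rintro ⟨n, k⟩
  calc _ = ‖weight q lam z n‖ * (‖x‖ ^ k * ‖(qPochFin q (q : ℂ) k)⁻¹‖ *
        ‖ratio q lam b (n - k)‖) := by
        simp only [norm_mul, div_eq_mul_inv, norm_pow]
    _ ≤ ‖weight q lam z n‖ * (‖x‖ ^ k * C₂ *
          (C * ((s₁⁻¹) ^ (n - k : ℤ) + (s₂⁻¹) ^ (n - k : ℤ)))) := by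
        gcongr
        exacts [h₂ k, h _]
    _ = _ := by
        rw [zpow_sub₀ (inv_pos.2 hp₁).ne', zpow_sub₀ (inv_pos.2 hp₂).ne', zpow_natCast,
          zpow_natCast, inv_pow, inv_pow, div_inv_eq_mul, div_inv_eq_mul, mul_pow, mul_pow]
        ring

/-- Euler's series for (-aq^n λ;q)_∞, with its Gaussian factors absorbed as shifts of the weight. -/
theorem symmTerm_eq (hq0 : 0 < q) (hq1 : q < 1) {lam z : ℂ} (hlam0 : lam ≠ 0) (hz0 : z ≠ 0)
    (a b : ℂ) (n : ℤ) : symmTerm q lam a b z n = ∑' k : ℕ, weight q lam z (n + k) *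
      ((a * z) ^ k / qPochFin q (q : ℂ) k * ratio q lam b n) := by
  have h := tsum_euler hq0 hq1 (a * (q : ℂ) ^ n * lam)
  have e : symmTerm q lam a b z n = qPoch q (-(a * (q : ℂ) ^ n * lam)) *
      (ratio q lam b n * weight q lam z n) := by
    rw [symmTerm, ratio, weight]
    ring
  rw [e, ← h, ← tsum_mul_right]
  refine tsum_congr fun k => ?_
  have h1 := weight_mul_pow hq0 hq1 hlam0 hz0 n k
  rw [weight, weight, mul_assoc a, mul_pow, mul_pow a z]
  linear_combination (a ^ k / qPochFin q (q : ℂ) k * ratio q lam b n) * h1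

theorem symm_form (hq0 : 0 < q) (hq1 : q < 1) {lam z : ℂ} (hlam0 : lam ≠ 0) (hz0 : z ≠ 0)
    (hlam : ∀ n : ℤ, lam ≠ -(q : ℂ) ^ n) (hz : ∀ n : ℤ, z ≠ -((q : ℂ) ^ n * lam)) {a b : ℂ}
    (habz : ‖a * b * z‖ < 1) :
    Summable (symmTerm q lam a b z) ∧
      qU q lam a b z = qPoch q (a * b * z) * ∑' n : ℤ, symmTerm q lam a b z n := by
  have hs := summable_ratio_sub hq0 hq1 hlam0 hz0 hlam (x := a * z) (b := b) (by
    rw [← norm_mul]; convert habz using 2; ring)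
  set f : ℤ → ℕ → ℂ := fun n k => weight q lam z (n + k) *
      ((a * z) ^ k / qPochFin q (q : ℂ) k * ratio q lam b n) with hf
  have hs' : Summable fun p : ℤ × ℕ => f (p.1 - p.2) p.2 := by
    simpa only [hf, sub_add_cancel] using hs
  have hfs := (summable_shear_iff (f := f)).1 hs'
  refine ⟨hfs.prod.congr fun n => (symmTerm_eq hq0 hq1 hlam0 hz0 a b n).symm, ?_⟩
  rw [tsum_congr (symmTerm_eq hq0 hq1 hlam0 hz0 a b), tsum_shear (f := f) hfs,
    qU_eq_tsum_outTerm hq0 hq1 hlam0 hz0 hlam, ← tsum_mul_left]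
  refine tsum_congr fun n => ?_
  simp only [hf, sub_add_cancel]
  have hr : ∀ j : ℕ, outTerm q lam b (n - j) 0 = ratio q lam b (n - j) := fun j => by
    simp [outTerm, ratio, qPochFin_zero]
  have h := tsum_qDiff hq0 hq1 b (a * z) (Y := fun k j => outTerm q lam b (n - j) k)
    (fun k m => by
      have := outTerm_succ hq0 hq1 hlam b (n - m) k
      rw [this]
      push_cast
      ring_nf)
    (by
      simp only [hr]
      have h1 := hs.prod_factor n
      -- A row of the double series contains the constant factor w_n; it can be cancelled because z
      -- avoids the points -q^n λ.
      exact ((summable_mul_left_iff (weight_ne_zero hq0 hq1 hz0 hz n)).1 h1).norm)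
  simp only [hr, Nat.cast_zero, sub_zero] at h
  rw [h, tsum_mul_left, show b * (a * z) = a * b * z by ring]
  ring

/-! ### The `q`-Pochhammer form -/

theorem summable_ratio_add (hq0 : 0 < q) (hq1 : q < 1) {lam z : ℂ} (hlam0 : lam ≠ 0) (hz0 : z ≠ 0)
    (hlam : ∀ n : ℤ, lam ≠ -(q : ℂ) ^ n) {a : ℂ} (ha : ‖a‖ < 1) (b : ℂ) :
    Summable fun p : ℤ × ℕ => weight q lam z p.1 *
      (a ^ p.2 / qPochFin q (q : ℂ) p.2 * ratio q lam b (p.1 + p.2)) := by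
  obtain ⟨C₂, hC₂, h₂⟩ := exists_norm_inv_qPochFin_self_le hq0 hq1
  have hp₂ : 0 < 1 + ‖b‖ := by positivity
  obtain ⟨C, hC, h⟩ := norm_ratio_le hq0 hq1 hlam0 hlam b one_pos le_rfl hp₂
    (by linarith : ‖b‖ ≤ 1 + ‖b‖)
  have key : ∀ s : ℝ, 1 ≤ s → Summable fun p : ℤ × ℕ =>
      ‖weight q lam z p.1‖ * (s⁻¹) ^ p.1 * (‖a‖ * s⁻¹) ^ p.2 := fun s hs => by
    have hs0 : 0 < s := by linarith
    refine (summable_weight hq0 hq1 hlam0 hz0 s⁻¹).mul_of_nonneg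
      (summable_geometric_of_lt_one (by positivity) ?_)
      (fun n => mul_nonneg (norm_nonneg _) (zpow_nonneg (inv_pos.2 hs0).le _))
      (fun n => by simp only [Pi.zero_apply]; positivity)
    exact (mul_le_of_le_one_right (norm_nonneg _) (inv_le_one_of_one_le₀ hs)).trans_lt ha
  refine Summable.of_norm_bounded
    (((key 1 le_rfl).add (key (1 + ‖b‖) (by linarith [norm_nonneg b]))).mul_left (C₂ * C)) ?_
  rintro ⟨n, k⟩
  calc _ = ‖weight q lam z n‖ * (‖a‖ ^ k * ‖(qPochFin q (q : ℂ) k)⁻¹‖ *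
        ‖ratio q lam b (n + k)‖) := by
        simp only [norm_mul, div_eq_mul_inv, norm_pow]
    _ ≤ ‖weight q lam z n‖ * (‖a‖ ^ k * C₂ *
          (C * (((1 : ℝ)⁻¹) ^ (n + k : ℤ) + ((1 + ‖b‖)⁻¹) ^ (n + k : ℤ)))) := by
        gcongr
        exacts [h₂ k, h _]
    _ = _ := by
        rw [zpow_add₀ (by norm_num), zpow_add₀ (inv_pos.2 hp₂).ne', zpow_natCast,
          zpow_natCast, mul_pow, mul_pow]
        ring

/-- A Heine-type transformation: ₂φ₁(a,b;0;q,-t) = (a;q)_∞ Σ_k a^k/(q;q)_k r(q^k t), where r(t) =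
(-bt;q)_∞/(-t;q)_∞. -/
theorem qUTerm_eq_tsum_ratio (hq0 : 0 < q) (hq1 : q < 1) {lam z : ℂ} (hlam0 : lam ≠ 0)
    (hz0 : z ≠ 0) (hlam : ∀ n : ℤ, lam ≠ -(q : ℂ) ^ n) (hz : ∀ n : ℤ, z ≠ -((q : ℂ) ^ n * lam))
    {a : ℂ} (ha : ‖a‖ < 1) (b : ℂ) (n : ℤ) :
    qUTerm q lam a b z n = qPoch q a * ∑' k : ℕ, weight q lam z n *
      (a ^ k / qPochFin q (q : ℂ) k * ratio q lam b (n + k)) := by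
  have hq := q_ne_zero hq0
  have e : ∀ j : ℕ, (q : ℂ) ^ n * lam * (q : ℂ) ^ j = (q : ℂ) ^ (n + j) * lam := fun j => by
    rw [zpow_add₀ hq, zpow_natCast]; ring
  have hr : ∀ j : ℕ, expTerm q b ((q : ℂ) ^ n * lam * (q : ℂ) ^ j) 0 = ratio q lam b (n + j) := by
    intro j
    rw [e]
    simp [expTerm, ratio, qPochFin_zero, mul_assoc]
  have h := tsum_qDiff hq0 hq1 1 a
    (Y := fun k j => expTerm q b ((q : ℂ) ^ n * lam * (q : ℂ) ^ j) k)
    (fun k m => by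
      rw [expTerm_succ hq0 hq1 b (fun i => by
        rw [e]; exact zpow_mul_pow_ne_one hq0 hlam _ i), one_mul, pow_succ, ← mul_assoc])
    (by
      simp only [hr]
      have h1 := (summable_ratio_add hq0 hq1 hlam0 hz0 hlam ha b).prod_factor n
      exact ((summable_mul_left_iff (weight_ne_zero hq0 hq1 hz0 hz n)).1 h1).norm)
  simp only [hr, pow_zero, mul_one, one_mul] at h
  rw [qUTerm_eq hq0 hq1 hlam, tsum_mul_left, h, tsum_mul_left]
  ring

theorem pochTerm_eq (hq0 : 0 < q) (hq1 : q < 1) {lam z : ℂ} (hlam0 : lam ≠ 0) (hz0 : z ≠ 0)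
    (a b : ℂ) (n : ℤ) : pochTerm q lam a b z n = ∑' k : ℕ, weight q lam z (n - k) *
      (a ^ k / qPochFin q (q : ℂ) k * ratio q lam b n) := by
  have hq := q_ne_zero hq0
  have h := tsum_euler hq0 hq1 (a * (q : ℂ) * z / ((q : ℂ) ^ n * lam))
  have e : pochTerm q lam a b z n = qPoch q (-(a * (q : ℂ) * z / ((q : ℂ) ^ n * lam))) *
      (ratio q lam b n * weight q lam z n) := by
    rw [pochTerm, ratio, weight]
    ring
  rw [e, ← h, ← tsum_mul_right]
  refine tsum_congr fun k => ?_
  have h1 := weight_mul_pow hq0 hq1 hlam0 hz0 (n - k) k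
  rw [sub_add_cancel] at h1
  -- The powers of q cancel because 2 (k choose 2) + k = k². The identity expresses w_{n-k} through
  -- w_n.
  have h2 : (q : ℂ) ^ (k.choose 2) * ((q : ℂ) * z / ((q : ℂ) ^ n * lam)) ^ k *
      ((q : ℂ) ^ (k.choose 2) * ((q : ℂ) ^ (n - k) * lam) ^ k) = z ^ k := by
    have h3 : (q : ℂ) ^ (k.choose 2) * (q : ℂ) ^ (k.choose 2) * (q : ℂ) ^ k =
        ((q : ℂ) ^ k) ^ k := by
      rw [← pow_add, ← pow_add, ← pow_mul]
      congr 1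
      have h5 := two_mul_tri k
      rw [tri_natCast] at h5
      zify
      linarith
    rw [zpow_sub₀ hq, zpow_natCast, div_pow, mul_pow, mul_pow, mul_pow, div_pow, ← h3]
    field_simp
  have h4 : weight q lam z (n - k) = (q : ℂ) ^ (k.choose 2) *
      ((q : ℂ) * z / ((q : ℂ) ^ n * lam)) ^ k * weight q lam z n := by
    have h5 : (q : ℂ) ^ (k.choose 2) * ((q : ℂ) ^ (n - k) * lam) ^ k ≠ 0 :=
      right_ne_zero_of_mul (h2 ▸ pow_ne_zero k hz0)
    refine mul_left_cancel₀ h5 (h1.trans ?_)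
    rw [← h2, weight]
    ring
  have h6 : a * (q : ℂ) * z / ((q : ℂ) ^ n * lam) = a * ((q : ℂ) * z / ((q : ℂ) ^ n * lam)) := by
    ring
  rw [h4, h6, mul_pow]
  ring

theorem poch_form (hq0 : 0 < q) (hq1 : q < 1) {lam z : ℂ} (hlam0 : lam ≠ 0) (hz0 : z ≠ 0)
    (hlam : ∀ n : ℤ, lam ≠ -(q : ℂ) ^ n) (hz : ∀ n : ℤ, z ≠ -((q : ℂ) ^ n * lam)) {a : ℂ}
    (ha : ‖a‖ < 1) (b : ℂ) :
    Summable (pochTerm q lam a b z) ∧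
      qU q lam a b z = qPoch q a * ∑' n : ℤ, pochTerm q lam a b z n := by
  have hs := summable_ratio_add hq0 hq1 hlam0 hz0 hlam ha b
  set f : ℤ → ℕ → ℂ := fun n k => weight q lam z n *
      (a ^ k / qPochFin q (q : ℂ) k * ratio q lam b (n + k)) with hf
  have hs' : Summable fun p : ℤ × ℕ => f (p.1 - p.2) p.2 := (summable_shear_iff (f := f)).2 hs
  have e : ∀ n, pochTerm q lam a b z n = ∑' k : ℕ, f (n - k) k := fun n => by
    rw [pochTerm_eq hq0 hq1 hlam0 hz0]; simp only [hf, sub_add_cancel]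
  refine ⟨hs'.prod.congr fun n => (e n).symm, ?_⟩
  rw [tsum_congr e, ← tsum_shear (f := f) hs, qU,
    tsum_congr (qUTerm_eq_tsum_ratio hq0 hq1 hlam0 hz0 hlam hz ha b), tsum_mul_left]

/-! ### The `₁φ₁` form -/

theorem qPhi_one_one (c d x : ℂ) : qPhi q [c] [d] x = ∑' k : ℕ,
    qPochFin q c k / (qPochFin q d k * qPochFin q (q : ℂ) k) *
      ((-1) ^ k * (q : ℂ) ^ (k.choose 2)) * x ^ k := by
  refine tsum_congr fun k => ?_
  simp

/-- Splitting (d;q)_∞ = (d;q)_k (dq^k;q)_∞ clears the denominators, leaving a series of Jackson's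
shape. -/
theorem qPoch_mul_qPhi_one_one (hq0 : 0 < q) (hq1 : q < 1) {d : ℂ}
    (hd : ∀ n : ℕ, d * (q : ℂ) ^ n ≠ 1) (c x : ℂ) :
    qPoch q d * qPhi q [c] [d] x = ∑' k : ℕ,
      (q : ℂ) ^ (k.choose 2) * (-x) ^ k / qPochFin q (q : ℂ) k * qPochFin q c k *
        qPoch q (d * (q : ℂ) ^ k) := by
  rw [qPhi_one_one, ← tsum_mul_left]
  refine tsum_congr fun k => ?_
  have h1 := qPochFin_ne_zero hd k
  have h2 := qPochFin_self_ne_zero hq0 hq1 k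
  rw [qPoch_eq_qPochFin_mul hq0 hq1 d k, neg_pow x]
  field_simp

theorem phi11_form (hq0 : 0 < q) (hq1 : q < 1) {lam : ℂ}
    (hlam : ∀ n : ℤ, lam ≠ -(q : ℂ) ^ n) {b : ℂ} (hb : ∀ n : ℤ, b * lam ≠ -(q : ℂ) ^ n)
    (a z : ℂ) (n : ℤ) : phi11Term q lam a b z n = qUTerm q lam a b z n := by
  have e : -(b * (q : ℂ) ^ n * lam) = -((q : ℂ) ^ n * (b * lam)) := by ring
  have h := qPoch_mul_qPhi_one_one hq0 hq1 (d := -(b * (q : ℂ) ^ n * lam))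
    (fun m => e ▸ zpow_mul_pow_ne_one hq0 hb n m) b (-(a * (q : ℂ) ^ n * lam))
  rw [phi11Term, qUTerm, phi21Cont_eq_jackson hq0 hq1 a b (neg_mem_borelDomain hq0 hlam n), jackson,
    h, div_div]
  congr 1
  refine tsum_congr fun k => ?_
  rw [jacksonCoeff, neg_neg, mul_assoc a, mul_pow a, neg_pow a, neg_pow ((q : ℂ) ^ n * lam),
    show b * -((q : ℂ) ^ n * lam) = -(b * (q : ℂ) ^ n * lam) by ring]
  have : ((-1 : ℂ) ^ k) * (-1) ^ k = 1 := by rw [← mul_pow]; simp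
  linear_combination -((q : ℂ) ^ k.choose 2 * a ^ k * ((q : ℂ) ^ n * lam) ^ k /
    qPochFin q (q : ℂ) k * qPochFin q b k * qPoch q (-(b * (q : ℂ) ^ n * lam) * (q : ℂ) ^ k)) * this

/-! ### The partial-fraction form -/

/-- The shear `(n, s) ↦ (n + s, s)`. -/
def intShear : ℤ × ℤ ≃ ℤ × ℤ where
  toFun p := (p.1 + p.2, p.2)
  invFun p := (p.1 - p.2, p.2)
  left_inv p := by simp
  right_inv p := by simp

theorem summable_intShear_iff {f : ℤ → ℤ → ℂ} :
    (Summable fun p : ℤ × ℤ => f (p.1 + p.2) p.2) ↔ Summable fun p : ℤ × ℤ => f p.1 p.2 :=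
  intShear.summable_iff (f := fun p : ℤ × ℤ => f p.1 p.2)

theorem tsum_intShear {f : ℤ → ℤ → ℂ} (hf : Summable fun p : ℤ × ℤ => f p.1 p.2) :
    ∑' n : ℤ, ∑' s : ℤ, f n s = ∑' n : ℤ, ∑' s : ℤ, f (n + s) s := by
  rw [← hf.tsum_prod, ← (summable_intShear_iff.2 hf).tsum_prod]
  exact (intShear.tsum_eq (fun p : ℤ × ℤ => f p.1 p.2)).symm

theorem qU_comm (lam a b z : ℂ) : qU q lam a b z = qU q lam b a z := by
  simp only [qU, qUTerm, phi21Cont_comm a b]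

theorem pfCoeff_eq {a : ℂ} (ha : a ≠ 0) (m : ℕ) :
    pfCoeff q a m = a ^ m * qPochFin q ((q : ℂ) / a) m := by
  induction m with
  | zero => simp [pfCoeff_zero, qPochFin_zero]
  | succ m ih =>
    rw [pfCoeff_succ, qPochFin_succ, ih]
    field_simp
    ring

theorem pochTerm_eq_tsum_pfWeight (hq0 : 0 < q) (hq1 : q < 1) {lam z : ℂ} (hlam0 : lam ≠ 0)
    (hz0 : z ≠ 0) (hz : ∀ n : ℤ, z ≠ -((q : ℂ) ^ n * lam)) (a : ℂ) {b : ℂ} (hb : ‖b‖ < 1) (n : ℤ) :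
    pochTerm q lam b a z n = -(qPoch q (q : ℂ) ^ 3)⁻¹ * ∑' s : ℤ,
      pfWeight q b s * ratio q lam a n *
        ((q : ℂ) ^ (n - s) * lam / ((q : ℂ) ^ (n - s) * lam + z)) := by
  have hq := q_ne_zero hq0
  have hQ := qPoch_self_ne_zero hq0 hq1
  have hqn := zpow_ne_zero n hq
  set τ : ℂ := z / ((q : ℂ) ^ n * lam) with hτ
  have hτ0 : τ ≠ 0 := div_ne_zero hz0 (mul_ne_zero hqn hlam0)
  have hτn : ∀ m : ℤ, τ ≠ -(q : ℂ) ^ m := fun m h => hz (m + n) (by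
    rw [hτ, div_eq_iff (mul_ne_zero hqn hlam0)] at h
    rw [h, zpow_add₀ hq]
    ring)
  have h := tsum_pfWeight hq0 hq1 hb hτ0 hτn
  have e1 : ∀ s : ℤ, pfWeight q b s * ratio q lam a n *
        ((q : ℂ) ^ (n - s) * lam / ((q : ℂ) ^ (n - s) * lam + z)) =
      ratio q lam a n * (pfWeight q b s * (1 + (q : ℂ) ^ s * τ)⁻¹) := by
    intro s
    have hqs := zpow_ne_zero s hq
    have e2 : 1 + (q : ℂ) ^ s * τ = ((q : ℂ) ^ (n - s) * lam + z) / ((q : ℂ) ^ (n - s) * lam) := by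
      rw [hτ, zpow_sub₀ hq]
      field_simp
    rw [e2, inv_div]
    ring
  have e3 : (q : ℂ) ^ n * lam / z = (q : ℂ) / (q * τ) := by
    rw [hτ]; field_simp
  have e4 : b * (q : ℂ) * z / ((q : ℂ) ^ n * lam) = b * q * τ := by
    rw [hτ]; ring
  rw [tsum_congr e1, tsum_mul_left, h, pochTerm, ratio, e3, qTheta_div _ hq0, e4]
  field_simp

theorem exists_norm_kernel_le (hq0 : 0 < q) (hq1 : q < 1) {lam z : ℂ} (hlam0 : lam ≠ 0)
    (hz0 : z ≠ 0) : ∃ C : ℝ, 0 ≤ C ∧ ∀ n : ℤ,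
      ‖(q : ℂ) ^ n * lam / ((q : ℂ) ^ n * lam + z)‖ ≤ C ∧
      ‖(q : ℂ) ^ n * lam / ((q : ℂ) ^ n * lam + z)‖ ≤ C * q ^ n := by
  have hq := q_ne_zero hq0
  obtain ⟨C₁, h₁, hC₁⟩ := exists_norm_inv_one_add_zpow_le hq0 hq1 (div_ne_zero hlam0 hz0)
  obtain ⟨C₂, h₂, hC₂⟩ := exists_norm_inv_one_add_zpow_le hq0 hq1 (div_ne_zero hz0 hlam0)
  refine ⟨C₂ + C₁ * (‖lam‖ / ‖z‖), by positivity, fun n => ⟨?_, ?_⟩⟩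
  · have hqn := zpow_ne_zero n hq
    have e : (q : ℂ) ^ n * lam / ((q : ℂ) ^ n * lam + z) =
        (1 + (q : ℂ) ^ (-n) * (z / lam))⁻¹ := by
      have e2 : 1 + (q : ℂ) ^ (-n) * (z / lam) =
          ((q : ℂ) ^ n * lam + z) / ((q : ℂ) ^ n * lam) := by
        rw [zpow_neg]; field_simp
      rw [e2, inv_div]
    rw [e]
    exact (hC₂ _).trans (le_add_of_nonneg_right (by positivity))
  · have e : (q : ℂ) ^ n * lam / ((q : ℂ) ^ n * lam + z) =
        (1 + (q : ℂ) ^ n * (lam / z))⁻¹ * ((lam / z) * (q : ℂ) ^ n) := by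
      have e2 : 1 + (q : ℂ) ^ n * (lam / z) = ((q : ℂ) ^ n * lam + z) / z := by
        field_simp; ring
      rw [e2, inv_div]
      field_simp
    have hp := zpow_pos hq0 n
    rw [e, norm_mul, norm_mul, norm_zpow_q hq0, norm_div, ← mul_assoc]
    gcongr
    calc _ ≤ C₁ * (‖lam‖ / ‖z‖) := by gcongr; exact hC₁ n
      _ ≤ _ := le_add_of_nonneg_left h₂.le

theorem summable_pow_natAbs {ρ : ℝ} (h0 : 0 ≤ ρ) (h1 : ρ < 1) :
    Summable fun n : ℤ => ρ ^ n.natAbs :=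
  Summable.of_nat_of_neg (by simpa using summable_geometric_of_lt_one h0 h1)
    (by simpa using summable_geometric_of_lt_one h0 h1)

/-- Choose σ between max(‖a‖, ‖b‖) and 1. For n ≥ 0 the kernel is O(q^n) and the ratio is bounded.
For n ≤ 0 the kernel is bounded and the ratio is O(σ^(-n-s)); the factor σ^(-s) is absorbed by the
coefficients because ‖b‖ < σ. -/
theorem summable_pfWeight_mul_ratio (hq0 : 0 < q) (hq1 : q < 1) {lam z : ℂ} (hlam0 : lam ≠ 0)
    (hz0 : z ≠ 0) (hlam : ∀ n : ℤ, lam ≠ -(q : ℂ) ^ n) {a b : ℂ} (ha : ‖a‖ < 1) (hb : ‖b‖ < 1) :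
    Summable fun p : ℤ × ℤ => pfWeight q b p.2 * ratio q lam a (p.1 + p.2) *
      ((q : ℂ) ^ p.1 * lam / ((q : ℂ) ^ p.1 * lam + z)) := by
  obtain ⟨σ, hσ, hσ1⟩ := exists_between (max_lt ha hb)
  have haσ : ‖a‖ < σ := (le_max_left _ _).trans_lt hσ
  have hbσ : ‖b‖ < σ := (le_max_right _ _).trans_lt hσ
  have hσ0 : 0 < σ := (norm_nonneg a).trans_lt haσ
  obtain ⟨C₁, hC₁, h₁⟩ := norm_ratio_le hq0 hq1 hlam0 hlam a one_pos le_rfl one_pos ha.le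
  obtain ⟨C₂, hC₂, h₂⟩ := norm_ratio_le hq0 hq1 hlam0 hlam a hσ0 hσ1.le hσ0 haσ.le
  obtain ⟨C₃, hC₃, h₃⟩ := exists_norm_kernel_le hq0 hq1 hlam0 hz0
  have hρ1 : max q σ < 1 := max_lt hq1 hσ1
  have hρ0 : 0 ≤ max q σ := hq0.le.trans (le_max_left _ _)
  have s1 := (summable_norm_pfWeight hq0 hq1 one_pos hb).add
    (summable_norm_pfWeight hq0 hq1 hσ0 hbσ)
  have hnn : ∀ s : ℤ, 0 ≤ ‖pfWeight q b s‖ * (1⁻¹ : ℝ) ^ s + ‖pfWeight q b s‖ * (σ⁻¹) ^ s :=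
    fun s => add_nonneg (by simp)
      (mul_nonneg (norm_nonneg _) (zpow_nonneg (inv_pos.2 hσ0).le _))
  refine Summable.of_norm_bounded (((summable_pow_natAbs hρ0 hρ1).mul_of_nonneg s1
    (fun n => pow_nonneg hρ0 _) hnn).mul_left (2 * (C₁ + C₂) * C₃)) ?_
  rintro ⟨n, s⟩
  have hσs : 0 < σ⁻¹ ^ s := zpow_pos (inv_pos.2 hσ0) s
  have hP : 0 ≤ ‖pfWeight q b s‖ := norm_nonneg _
  simp only [norm_mul _ ((q : ℂ) ^ n * lam / _), norm_mul (pfWeight q b s), inv_one, one_zpow,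
    mul_one] at h₁ ⊢
  obtain ⟨k, rfl | rfl⟩ := n.eq_nat_or_neg
  · have h4 : q ^ k ≤ max q σ ^ k := pow_le_pow_left₀ hq0.le (le_max_left _ _) k
    rw [Int.natAbs_natCast]
    have h5 := (h₃ k).2
    rw [zpow_natCast q] at h5
    calc _ ≤ ‖pfWeight q b s‖ * (C₁ * (1 + 1)) * (C₃ * max q σ ^ k) := by
          gcongr
          · exact h₁ _
          · exact h5.trans (by gcongr)
      _ = (2 * C₁ * C₃) * (max q σ ^ k * ‖pfWeight q b s‖) := by ring
      _ ≤ (2 * (C₁ + C₂) * C₃) * (max q σ ^ k * (‖pfWeight q b s‖ +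
            ‖pfWeight q b s‖ * σ⁻¹ ^ s)) := by
          gcongr
          · exact le_add_of_nonneg_right hC₂
          · exact le_add_of_nonneg_right (by positivity)
  · have h4 : σ ^ k ≤ max q σ ^ k := pow_le_pow_left₀ hσ0.le (le_max_right _ _) k
    have h5 : σ⁻¹ ^ (-(k : ℤ) + s) = σ ^ k * σ⁻¹ ^ s := by
      rw [zpow_add₀ (inv_pos.2 hσ0).ne', inv_zpow, zpow_neg, inv_inv, zpow_natCast]
    rw [Int.natAbs_neg, Int.natAbs_natCast]
    calc _ ≤ ‖pfWeight q b s‖ * (C₂ * (max q σ ^ k * σ⁻¹ ^ s + max q σ ^ k * σ⁻¹ ^ s)) * C₃ := by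
          gcongr
          · refine (h₂ _).trans ?_
            rw [h5]
            gcongr
          · exact (h₃ _).1
      _ = (2 * C₂ * C₃) * (max q σ ^ k * (‖pfWeight q b s‖ * σ⁻¹ ^ s)) := by ring
      _ ≤ (2 * (C₁ + C₂) * C₃) * (max q σ ^ k * (‖pfWeight q b s‖ +
            ‖pfWeight q b s‖ * σ⁻¹ ^ s)) := by
          gcongr
          · exact le_add_of_nonneg_left hC₁
          · exact le_add_of_nonneg_left hP

/-- Expand the ratio over its poles, exchange the sums, and resum over s at τ = q^(n+m)λ.
Quasi-periodicity of theta contributes q^(m choose 2) T^m, and the coefficients a^m (q/a;q)_m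
complete the ₁φ₁ series. -/
theorem tsum_pfWeight_mul_ratio (hq0 : 0 < q) (hq1 : q < 1) {lam : ℂ} (hlam0 : lam ≠ 0)
    (hlam : ∀ n : ℤ, lam ≠ -(q : ℂ) ^ n) {a b : ℂ} (ha0 : a ≠ 0) (ha : ‖a‖ < 1) (hb : ‖b‖ < 1)
    (hbl : ∀ n : ℤ, b * lam ≠ -(q : ℂ) ^ n) (n : ℤ) :
    ∑' s : ℤ, pfWeight q b s * ratio q lam a (n + s) =
      -(qPoch q a * qPoch q (q : ℂ) ^ 2) * (qPoch q (-(b * (q : ℂ) ^ (n + 1) * lam)) *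
        qPhi q [(q : ℂ) / a] [-(b * (q : ℂ) ^ (n + 1) * lam)] (-(a * (q : ℂ) ^ (n + 1) * lam)) /
          qTheta q ((q : ℂ) ^ (n + 1) * lam)) := by
  have hq := q_ne_zero hq0
  have hQ := qPoch_self_ne_zero hq0 hq1
  have hPa := qPoch_ne_zero_of_norm_lt_one hq0 hq1 ha
  set T : ℂ := (q : ℂ) ^ (n + 1) * lam with hT
  have hT0 : T ≠ 0 := mul_ne_zero (zpow_ne_zero _ hq) hlam0
  have hd : ∀ m : ℕ, -(b * (q : ℂ) ^ (n + 1) * lam) * (q : ℂ) ^ m ≠ 1 := fun m => by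
    have h := zpow_mul_pow_ne_one hq0 hbl (n + 1) m
    rwa [mul_left_comm, ← mul_assoc] at h
  have hr : ∀ s : ℤ, ratio q lam a (n + s) = qPoch q a / qPoch q (q : ℂ) *
      ∑' m : ℕ, pfCoeff q a m / qPochFin q (q : ℂ) m *
        (1 + (q : ℂ) ^ s * ((q : ℂ) ^ (n + m) * lam))⁻¹ := by
    intro s
    have h := tsum_partialFraction hq0 hq1 ha (t := (q : ℂ) ^ (n + s) * lam)
      (fun m => zpow_mul_pow_ne_one hq0 hlam _ m)
    have e : ∀ m : ℕ, 1 + (q : ℂ) ^ s * ((q : ℂ) ^ (n + m) * lam) =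
        1 + (q : ℂ) ^ (n + s) * lam * (q : ℂ) ^ m := fun m => by
      rw [zpow_add₀ hq, zpow_add₀ hq, zpow_natCast]; ring
    simp only [e]
    rw [h, ratio, ← mul_assoc a]
    field_simp
  obtain ⟨C, hC0, hC⟩ := exists_norm_inv_one_add_zpow_le hq0 hq1 hlam0
  have hsum : Summable (Function.uncurry fun (s : ℤ) (m : ℕ) => pfWeight q b s *
      (pfCoeff q a m / qPochFin q (q : ℂ) m *
        (1 + (q : ℂ) ^ s * ((q : ℂ) ^ (n + m) * lam))⁻¹)) := by
    refine Summable.of_norm_bounded (((summable_norm_pfWeight hq0 hq1 one_pos hb).mul_of_nonneg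
      (summable_norm_pfCoeff_div hq0 hq1 ha) (fun s => by simp)
      (fun _ => norm_nonneg _)).mul_right C) ?_
    rintro ⟨s, m⟩
    rw [Function.uncurry_apply_pair, norm_mul, norm_mul, inv_one, one_zpow, mul_one, ← mul_assoc]
    gcongr
    rw [← mul_assoc, ← zpow_add₀ hq]
    exact hC _
  have hin : ∀ m : ℕ, ∑' s : ℤ, pfWeight q b s * (1 + (q : ℂ) ^ s * ((q : ℂ) ^ (n + m) * lam))⁻¹ =
      -(qPoch q (q : ℂ) ^ 3 * (qPoch q (-(b * (q : ℂ) ^ (n + 1) * lam) * (q : ℂ) ^ m) *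
        ((q : ℂ) ^ (m.choose 2) * T ^ m * (qTheta q T)⁻¹))) := by
    intro m
    have h := tsum_pfWeight hq0 hq1 hb (τ := (q : ℂ) ^ (n + m) * lam)
      (mul_ne_zero (zpow_ne_zero _ hq) hlam0) (fun k h => hlam (k - (n + m)) (by
        have := zpow_ne_zero (n + m) hq
        rw [zpow_sub₀ hq, ← neg_div, ← h]
        field_simp))
    have h1 := inv_qTheta_zpow_mul hq0 hq1 hT0 m
    have e1 : (q : ℂ) ^ (m : ℤ) * T = q * ((q : ℂ) ^ (n + m) * lam) := by
      rw [hT, zpow_add₀ hq, zpow_add₀ hq, zpow_one]; ring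
    have e2 : -(b * q * ((q : ℂ) ^ (n + m) * lam)) =
        -(b * (q : ℂ) ^ (n + 1) * lam) * (q : ℂ) ^ m := by
      rw [zpow_add₀ hq, zpow_add₀ hq, zpow_one, zpow_natCast]; ring
    rw [e1, tri_natCast, zpow_natCast, zpow_natCast] at h1
    rw [h, div_eq_mul_inv, h1, e2]
  rw [qPoch_mul_qPhi_one_one hq0 hq1 hd]
  calc ∑' s : ℤ, pfWeight q b s * ratio q lam a (n + s)
      = qPoch q a / qPoch q (q : ℂ) * ∑' s : ℤ, ∑' m : ℕ, pfWeight q b s *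
          (pfCoeff q a m / qPochFin q (q : ℂ) m *
            (1 + (q : ℂ) ^ s * ((q : ℂ) ^ (n + m) * lam))⁻¹) := by
        rw [← tsum_mul_left]
        refine tsum_congr fun s => ?_
        rw [hr, tsum_mul_left]
        ring
    _ = qPoch q a / qPoch q (q : ℂ) * ∑' m : ℕ, ∑' s : ℤ, pfWeight q b s *
          (pfCoeff q a m / qPochFin q (q : ℂ) m *
            (1 + (q : ℂ) ^ s * ((q : ℂ) ^ (n + m) * lam))⁻¹) := by
        rw [hsum.tsum_comm]
    _ = _ := by
        rw [← tsum_div_const, ← tsum_mul_left, ← tsum_mul_left]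
        refine tsum_congr fun m => ?_
        have e : ∀ s : ℤ, pfWeight q b s * (pfCoeff q a m / qPochFin q (q : ℂ) m *
            (1 + (q : ℂ) ^ s * ((q : ℂ) ^ (n + m) * lam))⁻¹) =
            pfCoeff q a m / qPochFin q (q : ℂ) m *
              (pfWeight q b s * (1 + (q : ℂ) ^ s * ((q : ℂ) ^ (n + m) * lam))⁻¹) := fun s => by ring
        rw [tsum_congr e, tsum_mul_left, hin, pfCoeff_eq ha0, neg_neg,
          mul_assoc a ((q : ℂ) ^ (n + 1)) lam, ← hT, mul_pow a T]
        field_simp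

theorem cauchyHeine_form (hq0 : 0 < q) (hq1 : q < 1) {lam z : ℂ} (hlam0 : lam ≠ 0) (hz0 : z ≠ 0)
    (hlam : ∀ n : ℤ, lam ≠ -(q : ℂ) ^ n) (hz : ∀ n : ℤ, z ≠ -((q : ℂ) ^ n * lam)) {a b : ℂ}
    (ha0 : a ≠ 0) (ha : ‖a‖ < 1) (hb : ‖b‖ < 1) (hbl : ∀ n : ℤ, b * lam ≠ -(q : ℂ) ^ n) :
    Summable (cauchyHeineTerm q lam a b z) ∧
      qU q lam a b z = qPoch q a * qPoch q b / qPoch q (q : ℂ) *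
        ∑' n : ℤ, cauchyHeineTerm q lam a b z n := by
  have hQ := qPoch_self_ne_zero hq0 hq1
  have hPa := qPoch_ne_zero_of_norm_lt_one hq0 hq1 ha
  have hs := summable_pfWeight_mul_ratio hq0 hq1 hlam0 hz0 hlam ha hb
  set f : ℤ → ℤ → ℂ := fun n s => pfWeight q b s * ratio q lam a n *
        ((q : ℂ) ^ (n - s) * lam / ((q : ℂ) ^ (n - s) * lam + z)) with hf
  have hs' : Summable fun p : ℤ × ℤ => f (p.1 + p.2) p.2 := by
    simpa only [hf, add_sub_cancel_right] using hs
  have hfs := (summable_intShear_iff (f := f)).1 hs'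
  have e : ∀ n : ℤ, ∑' s : ℤ, f (n + s) s =
      -(qPoch q a * qPoch q (q : ℂ) ^ 2) * cauchyHeineTerm q lam a b z n := by
    intro n
    simp only [hf, add_sub_cancel_right]
    rw [tsum_mul_right, tsum_pfWeight_mul_ratio hq0 hq1 hlam0 hlam ha0 ha hb hbl, cauchyHeineTerm]
    ring
  have hne : -(qPoch q a * qPoch q (q : ℂ) ^ 2) ≠ 0 :=
    neg_ne_zero.2 (mul_ne_zero hPa (pow_ne_zero 2 hQ))
  refine ⟨(summable_mul_left_iff hne).1 (hs'.prod.congr e), ?_⟩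
  -- After exchanging the parameters, b sits in the theta quotient and supplies the prefactor
  -- (b;q)_∞, while a stays in the ratio.
  rw [qU_comm, (poch_form hq0 hq1 hlam0 hz0 hlam hz hb a).2,
    tsum_congr (pochTerm_eq_tsum_pfWeight hq0 hq1 hlam0 hz0 hz a hb), tsum_mul_left,
    tsum_intShear (f := f) hfs, tsum_congr e, tsum_mul_left]
  field_simp

end QBorelLaplace

/-! ### Assembly of the four representations. -/

theorem theorem5p2 (q : ℝ) (hq0 : 0 < q) (hq1 : q < 1) (lam a b z : ℂ)
    (hlam0 : lam ≠ 0) (hlam : ∀ n : ℤ, lam ≠ -(q : ℂ) ^ n)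
    (hz0 : z ≠ 0) (hz : ∀ n : ℤ, z ≠ -((q : ℂ) ^ n * lam)) :
    -- the resummation is well defined
    (IsPhi21Continuation q a b (phi21Cont q a b) ∧ Summable (qUTerm q lam a b z)) ∧
    -- the `₁φ₁` form
    ((∀ n : ℤ, b * lam ≠ -(q : ℂ) ^ n) →
      Summable (phi11Term q lam a b z) ∧
      qU q lam a b z = ∑' n : ℤ, phi11Term q lam a b z n) ∧
    -- the `q`-Pochhammer form
    (‖a‖ < 1 →
      Summable (pochTerm q lam a b z) ∧
      qU q lam a b z = qPoch q a * ∑' n : ℤ, pochTerm q lam a b z n) ∧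
    -- the form that is symmetric in `a` and `b`
    (‖a * b * z‖ < 1 →
      Summable (symmTerm q lam a b z) ∧
      qU q lam a b z = qPoch q (a * b * z) * ∑' n : ℤ, symmTerm q lam a b z n) ∧
    -- the partial-fraction form
    (a ≠ 0 → ‖a‖ < 1 → ‖b‖ < 1 → (∀ n : ℤ, b * lam ≠ -(q : ℂ) ^ n) →
      Summable (cauchyHeineTerm q lam a b z) ∧
      qU q lam a b z =
        qPoch q a * qPoch q b / qPoch q (q : ℂ) * ∑' n : ℤ, cauchyHeineTerm q lam a b z n) := by
  have hU := QBorelLaplace.summable_qUTerm hq0 hq1 hlam0 hz0 hlam a b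
  refine ⟨⟨QBorelLaplace.isPhi21Continuation_phi21Cont hq0 hq1 a b, hU⟩, fun hb => ?_, fun ha => ?_,
    fun habz => ?_, fun ha0 ha hb hbl => ?_⟩
  · have h := QBorelLaplace.phi11_form hq0 hq1 hlam hb a z
    exact ⟨hU.congr fun n => (h n).symm, tsum_congr fun n => (h n).symm⟩
  · exact QBorelLaplace.poch_form hq0 hq1 hlam0 hz0 hlam hz ha b
  · exact QBorelLaplace.symm_form hq0 hq1 hlam0 hz0 hlam hz habz
  · exact QBorelLaplace.cauchyHeine_form hq0 hq1 hlam0 hz0 hlam hz ha0 ha hb hbl
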